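/- Let $k$ be a field, let $Q$ be the quiver with two vertices $1,2$, two loops $a,b$ at $1$ and an arrow $c\colon 1\to 2$, and for $q\in k$ let $\Lambda_q=kQ/\langle a^2,b^2,ab-qba,ac\rangle$ (paths are composed from left to right), with $e_1,e_2$ the vertex idempotents. Put $f^0_0=e_1$, $f^0_1=e_2$, and for $n\ge 1$ put $f^n_0=a^{n}$, $f^n_n=b^{n}$, $f^n_{n+1}=a^{n-1}c$ and $f^n_i=f^{n-1}_{i-1}b+(-q)^i f^{n-1}_i a$ for $0<i<n$, elements of $kQ$ (equal to the tensor algebra of the arrows over $kQ_0$). Let $\mathbb K_n=\bigoplus_{i=0}^{n+1}\Lambda_q\, o(f^n_i)\otimes_k t(f^n_i)\,\Lambda_q$, where $o$ and $t$ denote the origin and terminal idempotents, with bimodule generators $\varepsilon^n_i=o(f^n_i)\otimes t(f^n_i)$ and differential $$d(\varepsilon^n_i)=(1-\delta_{i,n})\big[a\varepsilon^{n-1}_i+(-1)^{n-i}q^i\varepsilon^{n-1}_ia\big]+(1-\delta_{i,0})\big[(-q)^{n-i}b\varepsilon^{n-1}_{i-1}+(-1)^n\varepsilon^{n-1}_{i-1}b\big]\quad(0\le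 i\le n),$$ $d(\varepsilon^1_2)=c\varepsilon^0_1-\varepsilon^0_0c$, and $d(\varepsilon^n_{n+1})=a\varepsilon^{n-1}_n+(-1)^n\varepsilon^{n-1}_0c$ for $n\ge 2$. Let $C^*=\bigoplus_n\operatorname{Hom}_{\Lambda_q^e}(\mathbb K_n,\Lambda_q)$, with differential $\varphi\mapsto\varphi d$, and write $\varphi=(\varphi(\varepsilon^n_0),\dots,\varphi(\varepsilon^n_{n+1}))$ for $\varphi$ of degree $n$. Writing $f^{m+n}_l=\sum_{i,j}\gamma^l_{ij}f^m_if^n_j$, that is, $\gamma^l_{ij}=(-q)^{i(n-j)}$ if $i\le m$, $j\le n$, $i+j=l$; for $l=m+n+1$, $\gamma^l_{0,n+1}=1$ if $n\ge1$ and $\gamma^l_{m+1,1}=1$ if $n=0$; and $\gamma^l_{ij}=0$ otherwise, the cup product of $\varphi$ of degree $m$ and $\mu$ of degree $n$ is given by $$(\varphi\smallsmile\mu)(\varepsilon^{m+n}_l)=(-1)^{mn}\sum_{i,j}\gamma^l_{ij}\,\varphi(\varepsilon^m_i)\,\mu(\varepsilon^n_j).$$ Call an element of $C^*$ nilpotent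 if one of its cup powers is a coboundary; for a cocycle this means that its class in Hochschild cohomology is nilpotent. Let $q=\pm1$, and let $Z^*\subseteq C^*$ be the $k$-span of the non-nilpotent cocycles of even degree of the form $(0,\dots,0,e_1,0,\dots,0)$ with $e_1$ in an even position (positions are counted from $0$). Then: 1. In degree $2n$, for even $r$ with $0\le r\le 2n$, there is a non-nilpotent cocycle with $e_1$ in position $r$ and $0$ elsewhere if and only if $r\ge 2$. 2. $Z^*$ is a graded subspace of $C^*$. It contains no nonzero coboundary, so it embeds in Hochschild cohomology, and it contains no nonzero nilpotent element. 3. $Z^*$ is closed under the cup product. The linear map that sends the cocycle with $e_1$ in even position $r$ of degree $2n$ to $x^{2n-r}y^r$ is an isomorphism of non-unital algebras from $Z^*$ onto the subalgebra $k[x^2,y^2]y^2$ of $k[x,y]$, and it preserves degrees, where $x$ and $y$ have degree $1$. 4. $k[x^2,y^2]y^2$ is not finitely generated as a (non-unital) $k$-algebra. 5. If $q=1$ and $\operatorname{char}k\ne2$, then for every cocycle $\varphi$ of degree $n>0$ there is exactly one $\zeta\in Z^*$ of degree $n$ such that $\varphi-\zeta$ is nilpotent. -/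

import Mathlib

open scoped TensorProduct DirectSum
open MulOpposite

/-- A path in a quiver, together with its end points. -/
structure AnyPath (V : Type*) [Quiver V] where
  source : V
  target : V
  path : Quiver.Path source target

/-- The path algebra `kQ`. -/
def PathAlgebra (k V : Type*) [Field k] [Quiver V] : Type _ := AnyPath V →₀ k

namespace PathAlgebra
variable {k V : Type*} [Field k] [Quiver V]

noncomputable instance : AddCommGroup (PathAlgebra k V) :=
  inferInstanceAs (AddCommGroup (AnyPath V →₀ k))
noncomputable instance : Module k (PathAlgebra k V) :=
  inferInstanceAs (Module k (AnyPath V →₀ k))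

variable (k) in
noncomputable def ofPath (p : AnyPath V) : PathAlgebra k V := Finsupp.single p 1

open Classical in
variable (k) in
/-- Concatenation of `p` followed by `q`, zero if they are not composable. -/
noncomputable def concat (p q : AnyPath V) : PathAlgebra k V :=
  if h : p.target = q.source then ofPath k ⟨p.source, q.target, (p.path.cast rfl h).comp q.path⟩
  else 0

noncomputable def mulHom : PathAlgebra k V →ₗ[k] PathAlgebra k V →ₗ[k] PathAlgebra k V :=
  Finsupp.linearCombination k fun p =>
    (Finsupp.linearCombination k fun q => concat k p q : PathAlgebra k V →ₗ[k] PathAlgebra k V)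

noncomputable instance : Mul (PathAlgebra k V) := ⟨fun x y => mulHom x y⟩

theorem mul_def (x y : PathAlgebra k V) : x * y = mulHom x y := rfl

theorem ofPath_mul (p q : AnyPath V) : ofPath k p * ofPath k q = concat k p q := by
  rw [mul_def, mulHom, ofPath, ofPath]
  erw [Finsupp.linearCombination_single, one_smul, Finsupp.linearCombination_single, one_smul]

theorem zero_mul' (x : PathAlgebra k V) : 0 * x = 0 := by simp [mul_def]
theorem mul_zero' (x : PathAlgebra k V) : x * 0 = 0 := by simp [mul_def]
theorem add_mul' (x y z : PathAlgebra k V) : (x + y) * z = x * z + y * z := by simp [mul_def]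
theorem mul_add' (x y z : PathAlgebra k V) : x * (y + z) = x * y + x * z := by simp [mul_def]
theorem smul_mul' (t : k) (x y : PathAlgebra k V) : (t • x) * y = t • (x * y) := by
  simp [mul_def]
theorem mul_smul' (t : k) (x y : PathAlgebra k V) : x * (t • y) = t • (x * y) := by
  simp [mul_def]

theorem induction_on {P : PathAlgebra k V → Prop} (x : PathAlgebra k V) (zero : P 0)
    (add : ∀ x y, P x → P y → P (x + y)) (path : ∀ (t : k) p, P (t • ofPath k p)) : P x := by
  refine Finsupp.induction_linear (motive := P) x zero add fun p t => ?_
  have h : (Finsupp.single p t : AnyPath V →₀ k) = t • Finsupp.single p 1 := by simp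
  rw [h]
  exact path t p

theorem concat_assoc (p q r : AnyPath V) :
    concat k p q * ofPath k r = ofPath k p * concat k q r := by
  obtain ⟨a, b, p⟩ := p
  obtain ⟨c, d, q⟩ := q
  obtain ⟨e, f, r⟩ := r
  by_cases h1 : b = c
  · subst h1
    by_cases h2 : d = e
    · subst h2
      simp [concat, ofPath_mul]
    · simp [concat, h2, ofPath_mul, mul_zero']
  · by_cases h2 : d = e
    · subst h2
      simp [concat, h1, ofPath_mul, zero_mul']
    · simp [concat, h1, h2, zero_mul', mul_zero']

variable [Fintype V]

noncomputable instance : One (PathAlgebra k V) := ⟨∑ v : V, ofPath k ⟨v, v, .nil⟩⟩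

theorem one_def : (1 : PathAlgebra k V) = ∑ v : V, ofPath k ⟨v, v, .nil⟩ := rfl

theorem one_mul_ofPath (p : AnyPath V) : 1 * ofPath k p = ofPath k p := by
  obtain ⟨a, b, p⟩ := p
  rw [one_def, mul_def, map_sum, LinearMap.sum_apply, Finset.sum_eq_single a]
  · rw [← mul_def, ofPath_mul]
    simp [concat]
  · intro v _ hv
    rw [← mul_def, ofPath_mul]
    simp [concat, hv]
  · simp

theorem ofPath_mul_one (p : AnyPath V) : ofPath k p * 1 = ofPath k p := by
  obtain ⟨a, b, p⟩ := p
  rw [one_def, mul_def, map_sum, Finset.sum_eq_single b]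
  · rw [← mul_def, ofPath_mul]
    simp [concat]
  · intro v _ hv
    rw [← mul_def, ofPath_mul]
    simp [concat, hv.symm]
  · simp

noncomputable instance : Ring (PathAlgebra k V) where
  __ := (inferInstance : AddCommGroup (PathAlgebra k V))
  mul x y := x * y
  one := 1
  left_distrib := mul_add'
  right_distrib := add_mul'
  zero_mul := zero_mul'
  mul_zero := mul_zero'
  mul_assoc x y z := by
    induction x using induction_on with
    | zero => simp [zero_mul']
    | add _ _ h h' => simp [add_mul', h, h']
    | path s p =>
      induction y using induction_on with
      | zero => simp [zero_mul', mul_zero']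
      | add _ _ h h' => simp [add_mul', mul_add', h, h']
      | path t q =>
        induction z using induction_on with
        | zero => simp [mul_zero']
        | add _ _ h h' => simp [mul_add', h, h']
        | path u r => simp [smul_mul', mul_smul', ofPath_mul, concat_assoc]
  one_mul x := by
    induction x using induction_on with
    | zero => exact mul_zero' _
    | add _ _ h h' => rw [mul_add', h, h']
    | path s p => rw [mul_smul', one_mul_ofPath]
  mul_one x := by
    induction x using induction_on with
    | zero => exact zero_mul' _
    | add _ _ h h' => rw [add_mul', h, h']
    | path s p => rw [smul_mul', ofPath_mul_one]

noncomputable instance : Algebra k (PathAlgebra k V) := Algebra.ofModule smul_mul' mul_smul'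

end PathAlgebra

namespace HochschildLambda

/-- The two vertices of the quiver. -/
inductive Vertex
  | one
  | two
  deriving DecidableEq

instance : Fintype Vertex := ⟨{.one, .two}, fun v => by cases v <;> simp⟩

/-- The arrows: two loops `a`, `b` at the first vertex, and `c` from the first to the second. -/
inductive Arrow : Vertex → Vertex → Type
  | a : Arrow .one .one
  | b : Arrow .one .one
  | c : Arrow .one .two

instance : Quiver Vertex := ⟨Arrow⟩

section Algebra
variable (k : Type*) [Field k]

/-- The path algebra `kQ`. -/
abbrev KQ : Type _ := PathAlgebra k Vertex

noncomputable def KQ.vertex (v : Vertex) : KQ k := PathAlgebra.ofPath k ⟨v, v, .nil⟩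

noncomputable def KQ.arrow {v w : Vertex} (x : Arrow v w) : KQ k :=
  PathAlgebra.ofPath k ⟨v, w, Quiver.Hom.toPath x⟩

variable {k}

theorem arrow_mul_vertex {v w : Vertex} (x : Arrow v w) (u : Vertex) :
    KQ.arrow k x * KQ.vertex k u = if w = u then KQ.arrow k x else 0 := by
  rw [KQ.arrow, KQ.vertex, PathAlgebra.ofPath_mul, PathAlgebra.concat]
  by_cases h : w = u
  · subst h; simp
  · simp [h]

theorem vertex_mul_arrow {v w : Vertex} (x : Arrow v w) (u : Vertex) :
    KQ.vertex k u * KQ.arrow k x = if u = v then KQ.arrow k x else 0 := by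
  rw [KQ.arrow, KQ.vertex, PathAlgebra.ofPath_mul, PathAlgebra.concat]
  by_cases h : u = v
  · subst h; simp; rfl
  · simp [h]

theorem vertex_mul_vertex (u v : Vertex) :
    KQ.vertex k u * KQ.vertex k v = if u = v then KQ.vertex k u else 0 := by
  rw [KQ.vertex, KQ.vertex, PathAlgebra.ofPath_mul, PathAlgebra.concat]
  by_cases h : u = v
  · subst h; simp
  · simp [h]

/-- Generators of the ideal `I = ⟨a², b², ab - q ba, ac⟩`. -/
inductive Rel (q : k) : KQ k → KQ k → Prop
  | aa : Rel q (KQ.arrow k .a * KQ.arrow k .a) 0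
  | bb : Rel q (KQ.arrow k .b * KQ.arrow k .b) 0
  | ab : Rel q (KQ.arrow k .a * KQ.arrow k .b) (q • (KQ.arrow k .b * KQ.arrow k .a))
  | ac : Rel q (KQ.arrow k .a * KQ.arrow k .c) 0

/-- The quiver algebra `Λ_q = kQ / I`. -/
def Lambda (q : k) : Type _ := RingQuot (Rel q)

variable (q : k)

noncomputable instance : Ring (Lambda q) := inferInstanceAs (Ring (RingQuot (Rel q)))
noncomputable instance : Algebra k (Lambda q) := inferInstanceAs (Algebra k (RingQuot (Rel q)))

/-- The quotient map `kQ → Λ_q`. -/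
noncomputable def Lambda.mk : KQ k →ₐ[k] Lambda q := RingQuot.mkAlgHom k (Rel q)

noncomputable def e₁ : Lambda q := Lambda.mk q (KQ.vertex k .one)
noncomputable def e₂ : Lambda q := Lambda.mk q (KQ.vertex k .two)
noncomputable def arrA : Lambda q := Lambda.mk q (KQ.arrow k .a)
noncomputable def arrB : Lambda q := Lambda.mk q (KQ.arrow k .b)
noncomputable def arrC : Lambda q := Lambda.mk q (KQ.arrow k .c)

/-- The enveloping algebra `Λᵉ = Λ ⊗ Λᵒᵖ`. -/
def Env : Type _ := Lambda q ⊗[k] (Lambda q)ᵐᵒᵖ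

noncomputable instance : Ring (Env q) := inferInstanceAs (Ring (Lambda q ⊗[k] (Lambda q)ᵐᵒᵖ))
noncomputable instance : Algebra k (Env q) :=
  inferInstanceAs (Algebra k (Lambda q ⊗[k] (Lambda q)ᵐᵒᵖ))

/-- The element `x ⊗ y` of `Λᵉ`. -/
noncomputable def Env.mk (x y : Lambda q) : Env q := (x ⊗ₜ[k] op y : Lambda q ⊗[k] (Lambda q)ᵐᵒᵖ)

theorem Env.mk_mul_mk (x y x' y' : Lambda q) :
    Env.mk q x y * Env.mk q x' y' = Env.mk q (x * x') (y' * y) :=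
  Algebra.TensorProduct.tmul_mul_tmul _ _ _ _

theorem Env.induction_on {P : Env q → Prop} (u : Env q) (zero : P 0)
    (mk : ∀ x y, P (Env.mk q x y)) (add : ∀ u v, P u → P v → P (u + v)) : P u :=
  TensorProduct.induction_on u zero (fun x y => mk x y.unop) add

/-- `Λ` as a left `Λᵉ`-module, with `(x ⊗ y) • z = x * z * y`. -/
noncomputable instance : Module (Env q) (Lambda q) :=
  (TensorProduct.Algebra.module : Module (Lambda q ⊗[k] (Lambda q)ᵐᵒᵖ) (Lambda q))

theorem Env.mk_smul (x y z : Lambda q) : Env.mk q x y • z = x * z * y := by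
  change x • op y • z = _
  simp [mul_assoc]

instance : IsScalarTower k (Env q) (Lambda q) where
  smul_assoc t u z := by
    induction u using Env.induction_on with
    | zero => simp
    | add u v hu hv => rw [smul_add, add_smul, hu, hv, add_smul, smul_add]
    | mk x y =>
      have h : t • Env.mk q x y = Env.mk q (t • x) y := rfl
      rw [h, Env.mk_smul, Env.mk_smul, smul_mul_assoc, smul_mul_assoc]

instance : SMulCommClass (Env q) k (Lambda q) := IsScalarTower.to_smulCommClass'

end Algebra

section Resolution
variable {k : Type*} [Field k] (q : k)

/-- The elements `f^n_i` of `kQ`, for `0 ≤ i ≤ n + 1`. -/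
noncomputable def f : ℕ → ℕ → KQ k
  | 0, i => if i = 0 then KQ.vertex k .one else if i = 1 then KQ.vertex k .two else 0
  | n + 1, i =>
    if i = 0 then KQ.arrow k .a ^ (n + 1)
    else if i < n + 1 then
      f n (i - 1) * KQ.arrow k .b + (-q) ^ i • (f n i * KQ.arrow k .a)
    else if i = n + 1 then KQ.arrow k .b ^ (n + 1)
    else if i = n + 2 then KQ.arrow k .a ^ n * KQ.arrow k .c
    else 0

/-- The origin `o(f^n_i)`: it is `e₁`, except for `f^0_1 = e₂`. -/
noncomputable def orig (n i : ℕ) : Lambda q := if n = 0 ∧ i = 1 then e₂ q else e₁ q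

/-- The terminus `t(f^n_i)`: it is `e₂` for `i = n + 1`, and `e₁` for `i ≤ n`. -/
noncomputable def term (n i : ℕ) : Lambda q := if i = n + 1 then e₂ q else e₁ q

theorem e₁_mul_e₁ : e₁ q * e₁ q = e₁ q := by
  rw [e₁, ← map_mul, vertex_mul_vertex, if_pos rfl]

theorem e₂_mul_e₂ : e₂ q * e₂ q = e₂ q := by
  rw [e₂, ← map_mul, vertex_mul_vertex, if_pos rfl]

theorem orig_mul_self (n i : ℕ) : orig q n i * orig q n i = orig q n i := by
  unfold orig; split_ifs <;> simp [e₁_mul_e₁, e₂_mul_e₂]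

theorem term_mul_self (n i : ℕ) : term q n i * term q n i = term q n i := by
  unfold term; split_ifs <;> simp [e₁_mul_e₁, e₂_mul_e₂]

/-- The element `o(f^n_i) ⊗ t(f^n_i)`. In `Λᵉ` one has
`(x ⊗ y) (o ⊗ t) = (x o) ⊗ (t y)`, so the left ideal that it generates is the bimodule
`Λ o(f^n_i) ⊗ t(f^n_i) Λ`. -/
noncomputable def idem (n i : ℕ) : Env q := Env.mk q (orig q n i) (term q n i)

/-- The bimodule `K_n = ⨁_{i = 0}^{n + 1} Λ o(f^n_i) ⊗ t(f^n_i) Λ`. -/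
noncomputable def K (n : ℕ) : Submodule (Env q) (Fin (n + 2) → Env q) :=
  Submodule.pi Set.univ fun i => Submodule.span (Env q) {idem q n i}

/-- The generator `ε^n_i` of `K_n`. -/
noncomputable def ε (n : ℕ) (i : Fin (n + 2)) : K q n :=
  ⟨Pi.single i (idem q n i), fun j _ => by
    by_cases h : j = i
    · subst h
      simp [Submodule.mem_span_singleton_self]
    · simp [Pi.single_eq_of_ne h]⟩

theorem idem_smul_ε (n : ℕ) (i : Fin (n + 2)) : idem q n i • ε q n i = ε q n i := by
  apply Subtype.ext
  change idem q n i • (Pi.single i (idem q n i) : Fin (n + 2) → Env q) = Pi.single i (idem q n i)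
  rw [← Pi.single_smul, smul_eq_mul, idem, Env.mk_mul_mk, orig_mul_self, term_mul_self]

/-- `ε^n_i` for a natural number `i`, zero for `i > n + 1`. -/
noncomputable def ε' (n i : ℕ) : K q n := if h : i < n + 2 then ε q n ⟨i, h⟩ else 0

/-- The `Λᵉ`-linear map on `K_n` with `ε^n_i ↦ v i`, where `v i ∈ o(f^n_i) M t(f^n_i)`. -/
noncomputable def liftK {M : Type*} [AddCommGroup M] [Module (Env q) M] (n : ℕ)
    (v : Fin (n + 2) → M) : K q n →ₗ[Env q] M :=
  ∑ i, (LinearMap.toSpanSingleton (Env q) M (v i)) ∘ₗ (LinearMap.proj i) ∘ₗ (K q n).subtype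

theorem liftK_ε {M : Type*} [AddCommGroup M] [Module (Env q) M] (n : ℕ)
    (v : Fin (n + 2) → M) (i : Fin (n + 2)) : liftK q n v (ε q n i) = idem q n i • v i := by
  simp only [liftK, LinearMap.sum_apply]
  rw [Finset.sum_eq_single i]
  · simp [ε]
  · intro j _ h
    simp [ε, Pi.single_eq_of_ne h]
  · simp

theorem liftK_zero {M : Type*} [AddCommGroup M] [Module (Env q) M] (n : ℕ) :
    liftK q n (0 : Fin (n + 2) → M) = 0 := by
  ext x
  simp [liftK]

theorem liftK_add {M : Type*} [AddCommGroup M] [Module (Env q) M] (n : ℕ)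
    (v w : Fin (n + 2) → M) : liftK q n (v + w) = liftK q n v + liftK q n w := by
  ext x
  simp [liftK, Finset.sum_add_distrib]

/-- `x m` for `x ∈ Λ`. -/
noncomputable def lact {n : ℕ} (x : Lambda q) (m : K q n) : K q n := Env.mk q x 1 • m

/-- `m x` for `x ∈ Λ`. -/
noncomputable def ract {n : ℕ} (m : K q n) (x : Lambda q) : K q n := Env.mk q 1 x • m

/-- The value `d(ε^{n+1}_i)` in `K_n`, for `0 ≤ i ≤ n + 2`. -/
noncomputable def dGen (n i : ℕ) : K q n :=
  if i ≤ n + 1 then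
    (if i = n + 1 then 0 else
      lact q (arrA q) (ε' q n i) +
        ((-1) ^ (n + 1 - i) * q ^ i) • ract q (ε' q n i) (arrA q)) +
    (if i = 0 then 0 else
      (-q) ^ (n + 1 - i) • lact q (arrB q) (ε' q n (i - 1)) +
        (-1 : k) ^ (n + 1) • ract q (ε' q n (i - 1)) (arrB q))
  else if n = 0 then
    lact q (arrC q) (ε' q n 1) - ract q (ε' q n 0) (arrC q)
  else
    lact q (arrA q) (ε' q n (n + 1)) + (-1 : k) ^ (n + 1) • ract q (ε' q n 0) (arrC q)

/-- The differential `d : K_{n+1} → K_n`. -/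
noncomputable def d (n : ℕ) : K q (n + 1) →ₗ[Env q] K q n :=
  liftK q (n + 1) fun i => dGen q n i

theorem mk_smul_lact {n : ℕ} {i : ℕ} {x o t : Lambda q} (hi : i < n + 2) (hx : o * x = x)
    (ht : t = term q n i) : Env.mk q o t • lact q x (ε' q n i) = lact q x (ε' q n i) := by
  simp only [lact, ε', dif_pos hi]
  rw [← idem_smul_ε, smul_smul, smul_smul, idem, Env.mk_mul_mk, Env.mk_mul_mk, smul_smul,
    Env.mk_mul_mk]
  simp [hx, ht, term_mul_self]

theorem mk_smul_ract {n : ℕ} {i : ℕ} {x o t : Lambda q} (hi : i < n + 2) (hx : x * t = x)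
    (ho : o = orig q n i) : Env.mk q o t • ract q (ε' q n i) x = ract q (ε' q n i) x := by
  simp only [ract, ε', dif_pos hi]
  rw [← idem_smul_ε, smul_smul, smul_smul, idem, Env.mk_mul_mk, Env.mk_mul_mk, smul_smul,
    Env.mk_mul_mk]
  simp [hx, ho, orig_mul_self]

theorem d_ε (n : ℕ) (i : Fin (n + 3)) : d q n (ε q (n + 1) i) = dGen q n i := by
  have hi := i.2
  have ha : e₁ q * arrA q = arrA q := by
    rw [e₁, arrA, ← map_mul, vertex_mul_arrow, if_pos rfl]
  have hb : e₁ q * arrB q = arrB q := by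
    rw [e₁, arrB, ← map_mul, vertex_mul_arrow, if_pos rfl]
  have hc : e₁ q * arrC q = arrC q := by
    rw [e₁, arrC, ← map_mul, vertex_mul_arrow, if_pos rfl]
  have ha' : arrA q * e₁ q = arrA q := by
    rw [e₁, arrA, ← map_mul, arrow_mul_vertex, if_pos rfl]
  have hb' : arrB q * e₁ q = arrB q := by
    rw [e₁, arrB, ← map_mul, arrow_mul_vertex, if_pos rfl]
  have hc' : arrC q * e₂ q = arrC q := by
    rw [e₂, arrC, ← map_mul, arrow_mul_vertex, if_pos rfl]
  have ho : orig q (n + 1) i = e₁ q := by rw [orig, if_neg (by omega)]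
  have ho' : ∀ j, j ≤ n → e₁ q = orig q n j := fun j hj => by rw [orig, if_neg (by omega)]
  have ht' : ∀ j, j ≤ n → e₁ q = term q n j := fun j hj => by rw [term, if_neg (by omega)]
  have ht2 : e₂ q = term q n (n + 1) := by rw [term, if_pos rfl]
  rw [d, liftK_ε, idem, ho]
  unfold dGen
  by_cases h1 : (i : ℕ) ≤ n + 1
  · have ht : term q (n + 1) i = e₁ q := by rw [term, if_neg (by omega)]
    rw [ht, if_pos h1, smul_add]
    congr 1
    · split_ifs with h2
      · exact smul_zero _
      · rw [smul_add, smul_comm, mk_smul_lact q (by omega) ha (ht' _ (by omega)),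
          mk_smul_ract q (by omega) ha' (ho' _ (by omega))]
    · split_ifs with h2
      · exact smul_zero _
      · rw [smul_add, smul_comm, smul_comm (_ : Env q), mk_smul_lact q (by omega) hb
          (ht' _ (by omega)), mk_smul_ract q (by omega) hb' (ho' _ (by omega))]
  · have ht : term q (n + 1) i = e₂ q := by rw [term, if_pos (by omega)]
    rw [ht, if_neg h1]
    split_ifs with h2
    · subst h2
      rw [smul_sub, mk_smul_lact q (by omega) hc ht2,
        mk_smul_ract q (by omega) hc' (ho' _ (by omega))]
    · rw [smul_add, smul_comm, mk_smul_lact q (by omega) ha ht2,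
        mk_smul_ract q (by omega) hc' (ho' _ (by omega))]

end Resolution

section Cochains
variable {k : Type*} [Field k] (q : k)

/-- The cochains of degree `n`: bimodule maps `K_n → Λ`. -/
abbrev Cochain (n : ℕ) : Type _ := K q n →ₗ[Env q] Lambda q

/-- The dual differential `d^*`. -/
noncomputable def dStar (n : ℕ) : Cochain q n →ₗ[k] Cochain q (n + 1) where
  toFun φ := φ ∘ₗ d q n
  map_add' _ _ := rfl
  map_smul' _ _ := rfl

/-- The coefficient of `ε^m_i ⊗ ε^n_j` in `Δ(ε^{m+n}_l)`, for the comultiplication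
`Δ : K → K ⊗_Λ K`. See `f_comul`. -/
def comulCoeff (m n l i j : ℕ) : k :=
  if l ≤ m + n then
    if i ≤ m ∧ j ≤ n ∧ i + j = l then (-q) ^ (i * (n - j)) else 0
  else if n = 0 then
    if i = m + 1 ∧ j = 1 then 1 else 0
  else
    if i = 0 ∧ j = n + 1 then 1 else 0

theorem f_succ (n l : ℕ) (hl : l ≤ n + 1) :
    f q (n + 1) l = (if 0 < l then f q n (l - 1) * KQ.arrow k .b else 0) +
      (if l ≤ n then (-q) ^ l • (f q n l * KQ.arrow k .a) else 0) := by
  have ha : f q n 0 * KQ.arrow k .a = KQ.arrow k .a ^ (n + 1) := by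
    cases n with
    | zero => simp [f, vertex_mul_arrow]
    | succ n => simp [f, pow_succ]
  have hb : f q n n * KQ.arrow k .b = KQ.arrow k .b ^ (n + 1) := by
    cases n with
    | zero => simp [f, vertex_mul_arrow]
    | succ n => simp [f, pow_succ]
  rcases Nat.eq_zero_or_pos l with rfl | h0
  · simp [f, ha]
  · rcases Nat.lt_or_ge l (n + 1) with h1 | h1
    · simp [f, h0, h0.ne', h1, Nat.lt_succ_iff.mp h1]
    · obtain rfl : l = n + 1 := le_antisymm hl h1
      simp [f, hb]

theorem f_mul_vertex (n l : ℕ) (hl : l ≤ n) : f q n l * KQ.vertex k .one = f q n l := by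
  cases n with
  | zero =>
    obtain rfl : l = 0 := by omega
    simp [f, vertex_mul_vertex]
  | succ n =>
    rw [f_succ q n l hl]
    split_ifs <;> simp [add_mul, mul_assoc, arrow_mul_vertex]

theorem f_add (m n l : ℕ) (hl : l ≤ m + n) :
    f q (m + n) l = ∑ i ∈ Finset.range (m + 1), if i ≤ l ∧ l ≤ i + n then
      (-q) ^ (i * (n - (l - i))) • (f q m i * f q n (l - i)) else 0 := by
  induction n generalizing l with
  | zero =>
    rw [Finset.sum_eq_single l]
    · have h : f q 0 0 = KQ.vertex k .one := by simp [f]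
      simp [h, f_mul_vertex q m l hl]
    · intro i _ hi
      rw [if_neg (by omega)]
    · intro h
      simp at h
      omega
  | succ n ih =>
    have key : ∀ i ∈ Finset.range (m + 1), (if i ≤ l ∧ l ≤ i + (n + 1) then
        (-q) ^ (i * (n + 1 - (l - i))) • (f q m i * f q (n + 1) (l - i)) else 0) =
        (if 0 < l then (if i ≤ l - 1 ∧ l - 1 ≤ i + n then
          (-q) ^ (i * (n - (l - 1 - i))) • (f q m i * f q n (l - 1 - i)) else 0) *
            KQ.arrow k .b else 0) +
        (if l ≤ m + n then (-q) ^ l • ((if i ≤ l ∧ l ≤ i + n then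
          (-q) ^ (i * (n - (l - i))) • (f q m i * f q n (l - i)) else 0) *
            KQ.arrow k .a) else 0) := by
      intro i hi
      rw [Finset.mem_range] at hi
      by_cases h : i ≤ l ∧ l ≤ i + (n + 1)
      · obtain ⟨j, rfl⟩ : ∃ j, l = i + j := ⟨l - i, by omega⟩
        rw [if_pos h, Nat.add_sub_cancel_left, f_succ q n j (by omega), mul_add, smul_add]
        congr 1
        · rcases Nat.eq_zero_or_pos j with rfl | hj
          · by_cases hi0 : 0 < i
            · rw [if_neg (by omega), if_pos (by omega), if_neg (by omega)]
              simp
            · simp [hi0]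
          · obtain ⟨j, rfl⟩ : ∃ t, j = t + 1 := ⟨j - 1, by omega⟩
            rw [if_pos hj, if_pos (by omega), if_pos (by omega)]
            have e1 : i + (j + 1) - 1 - i = j := by omega
            have e2 : n + 1 - (j + 1) = n - j := by omega
            rw [e1, e2, smul_mul_assoc, mul_assoc, Nat.add_sub_cancel]
        · by_cases hj : j ≤ n
          · rw [if_pos hj, if_pos (by omega), if_pos (by omega), smul_mul_assoc, mul_smul_comm,
              smul_smul, smul_smul, ← pow_add, ← pow_add, mul_assoc]
            congr 2
            obtain ⟨t, rfl⟩ : ∃ t, n = j + t := ⟨n - j, by omega⟩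
            have e1 : j + t + 1 - j = t + 1 := by omega
            rw [e1, Nat.add_sub_cancel_left]
            ring
          · rw [if_neg hj, if_neg (by omega : ¬ (i ≤ i + j ∧ i + j ≤ i + n))]
            simp
      · rw [if_neg h, if_neg (by omega : ¬ (i ≤ l ∧ l ≤ i + n))]
        by_cases h0 : 0 < l
        · rw [if_neg (by omega : ¬ (i ≤ l - 1 ∧ l - 1 ≤ i + n))]
          simp
        · simp [h0]
    rw [Finset.sum_congr rfl key, Finset.sum_add_distrib, ← add_assoc, f_succ q (m + n) l (by omega)]
    congr 1
    · split_ifs with h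
      · rw [ih (l - 1) (by omega), Finset.sum_mul]
      · simp
    · split_ifs with h
      · rw [ih l h, Finset.sum_mul, Finset.smul_sum]
      · simp

/-- The elements `f^n_i` satisfy `f^{m+n}_l = ∑ i j, comulCoeff m n l i j • f^m_i ⊗ f^n_j`, the
tensor product being concatenation in `kQ`, the tensor algebra of the arrows. This says that
`Δ(ε^{m+n}_l) = ∑ i j, comulCoeff m n l i j • ε^m_i ⊗ ε^n_j` is compatible, under
`ε^n_i ↦ 1 ⊗ f^n_i ⊗ 1`, with the comultiplication of the bar resolution. -/
theorem f_comul (m n l : ℕ) (h : l ≤ m + n + 1) :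
    f q (m + n) l = ∑ i : Fin (m + 2), ∑ j : Fin (n + 2),
      comulCoeff q m n l i j • (f q m i * f q n j) := by
  rw [Fin.sum_univ_eq_sum_range (fun i => ∑ j : Fin (n + 2),
    comulCoeff q m n l i j • (f q m i * f q n j))]
  simp_rw [fun i => Fin.sum_univ_eq_sum_range
    (fun j => comulCoeff q m n l i j • (f q m i * f q n j)) (n + 2)]
  rcases Nat.lt_or_ge (m + n) l with hl | hl
  · obtain rfl : l = m + n + 1 := by omega
    rcases Nat.eq_zero_or_pos n with rfl | hn
    · rw [Finset.sum_eq_single (m + 1), Finset.sum_eq_single 1]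
      · have h1 : f q m (m + 1) * KQ.vertex k .two = f q m (m + 1) := by
          cases m <;> simp [f, vertex_mul_vertex, mul_assoc, arrow_mul_vertex]
        have h2 : f q 0 1 = KQ.vertex k .two := by simp [f]
        simp [comulCoeff, h1, h2]
      · intro j _ hj
        simp [comulCoeff, hj]
      · simp
      · intro i _ hi
        simp [comulCoeff, hi]
      · simp
    · rw [Finset.sum_eq_single 0, Finset.sum_eq_single (n + 1)]
      · obtain ⟨n, rfl⟩ : ∃ t, n = t + 1 := ⟨n - 1, by omega⟩
        simp only [comulCoeff, if_false, Nat.add_eq_zero_iff, one_ne_zero, and_false,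
          and_self, if_true, ← add_assoc]
        cases m with
        | zero =>
          cases n with
          | zero => simp [f, vertex_mul_arrow]
          | succ n => simp [f, vertex_mul_arrow, pow_succ', ← mul_assoc]
        | succ m =>
          have e : m + 1 + n = m + n + 1 := by omega
          simp [f, ← mul_assoc, ← pow_add, e]
      · intro j _ hj
        simp [comulCoeff, hj, hn.ne']
      · simp
      · intro i _ hi
        simp [comulCoeff, hi, hn.ne']
      · simp
  · rw [f_add q m n l hl, Finset.sum_range_succ _ (m + 1), eq_comm, add_eq_left.mpr]
    · refine Finset.sum_congr rfl fun i hi => ?_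
      rw [Finset.mem_range] at hi
      split_ifs with h1
      · rw [Finset.sum_eq_single (l - i)]
        · rw [comulCoeff, if_pos hl, if_pos (by omega)]
        · intro j _ hj
          rw [comulCoeff, if_pos hl, if_neg (by omega), zero_smul]
        · intro h2
          rw [Finset.mem_range] at h2
          omega
      · refine Finset.sum_eq_zero fun j _ => ?_
        rw [comulCoeff, if_pos hl, if_neg (by omega), zero_smul]
    · refine Finset.sum_eq_zero fun j _ => ?_
      rw [comulCoeff, if_pos hl, if_neg (by omega), zero_smul]

/-- The value of `φ ⌣ μ = π (φ ⊗ μ) Δ` on `ε^{m+n}_l`, where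
`(φ ⊗ μ) (x ⊗ y) = (-1)^{mn} φ(x) ⊗ μ(y)` for `x` of degree `m` and `y` of degree `n`. -/
noncomputable def cupGen {m n : ℕ} (φ : Cochain q m) (μ : Cochain q n) (l : Fin (m + n + 2)) :
    Lambda q :=
  ((-1) ^ (m * n) : k) • ∑ i : Fin (m + 2), ∑ j : Fin (n + 2),
    comulCoeff q m n l i j • (φ (ε q m i) * μ (ε q n j))

/-- The cup product `φ ⌣ μ : K_{m+n} → Λ`. -/
noncomputable def cup {m n : ℕ} (φ : Cochain q m) (μ : Cochain q n) : Cochain q (m + n) :=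
  liftK q (m + n) (cupGen q φ μ)

theorem apply_ε {n : ℕ} (φ : Cochain q n) (i : Fin (n + 2)) :
    orig q n i * φ (ε q n i) * term q n i = φ (ε q n i) := by
  rw [← Env.mk_smul, ← idem, ← map_smul, idem_smul_ε]

theorem orig_mul_ε {n : ℕ} (φ : Cochain q n) (i : Fin (n + 2)) :
    orig q n i * φ (ε q n i) = φ (ε q n i) := by
  rw [← apply_ε q φ i, ← mul_assoc, ← mul_assoc, orig_mul_self]

theorem ε_mul_term {n : ℕ} (φ : Cochain q n) (i : Fin (n + 2)) :
    φ (ε q n i) * term q n i = φ (ε q n i) := by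
  rw [← apply_ε q φ i, mul_assoc, term_mul_self]

theorem cup_ε {m n : ℕ} (φ : Cochain q m) (μ : Cochain q n) (l : Fin (m + n + 2)) :
    cup q φ μ (ε q (m + n) l) = cupGen q φ μ l := by
  rw [cup, liftK_ε, idem, Env.mk_smul, cupGen, mul_smul_comm, smul_mul_assoc, Finset.mul_sum,
    Finset.sum_mul]
  congr 1
  refine Finset.sum_congr rfl fun i _ => ?_
  rw [Finset.mul_sum, Finset.sum_mul]
  refine Finset.sum_congr rfl fun j _ => ?_
  by_cases h : comulCoeff q m n l i j = 0
  · simp [h]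
  · have hl := l.2
    obtain ⟨h1, h2⟩ : orig q (m + n) l = orig q m i ∧ term q (m + n) l = term q n j := by
      unfold comulCoeff at h
      split_ifs at h with h0 h1 h1 h2 h2
      · constructor
        · rw [orig, orig, if_neg (by omega), if_neg (by omega)]
        · rw [term, term, if_neg (by omega), if_neg (by omega)]
      · exact absurd rfl h
      · subst h1
        have e : (l : ℕ) = i := by omega
        constructor
        · rw [e]; rfl
        · rw [term, term, if_pos (by omega), if_pos (by omega)]
      · exact absurd rfl h
      · constructor
        · rw [orig, orig, if_neg (by omega), if_neg (by omega)]
        · rw [term, term, if_pos (by omega), if_pos (by omega)]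
      · exact absurd rfl h
    rw [h1, h2, mul_smul_comm, smul_mul_assoc, ← mul_assoc, orig_mul_ε, mul_assoc, ε_mul_term]

/-- The space `C^*` of all cochains. -/
abbrev C : Type _ := ⨁ n, Cochain q n

noncomputable instance : DirectSum.GNonUnitalNonAssocSemiring (Cochain q) where
  mul φ μ := cup q φ μ
  mul_zero {_ n} φ := by
    have h : cupGen q φ (0 : Cochain q n) = 0 := by ext l; simp [cupGen]
    rw [cup, h, liftK_zero]
  zero_mul {m _} φ := by
    have h : cupGen q (0 : Cochain q m) φ = 0 := by ext l; simp [cupGen]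
    rw [cup, h, liftK_zero]
  mul_add φ μ ν := by
    have h : cupGen q φ (μ + ν) = cupGen q φ μ + cupGen q φ ν := by
      ext l; simp [cupGen, mul_add, Finset.sum_add_distrib]
    rw [cup, h, liftK_add]; rfl
  add_mul φ μ ν := by
    have h : cupGen q (φ + μ) ν = cupGen q φ ν + cupGen q μ ν := by
      ext l; simp [cupGen, add_mul, Finset.sum_add_distrib]
    rw [cup, h, liftK_add]; rfl

/-- The dual differential on `C^*`. -/
noncomputable def totalD : C q →ₗ[k] C q :=
  DirectSum.toModule k ℕ _ fun n => (DirectSum.lof k ℕ (Cochain q) (n + 1)) ∘ₗ dStar q n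

/-- The coboundaries. -/
noncomputable def coboundaries : Submodule k (C q) := LinearMap.range (totalD q)

/-- `cupPow z m` is the cup product `z ⌣ ⋯ ⌣ z` with `m + 1` factors. -/
noncomputable def cupPow (z : C q) : ℕ → C q
  | 0 => z
  | m + 1 => cupPow z m * z

/-- Some cup power of `z` is a coboundary. For a cocycle `z` this says that its class in
Hochschild cohomology is nilpotent. -/
def IsNilp (z : C q) : Prop := ∃ m, cupPow q z m ∈ coboundaries q

/-- A cochain of degree `n`, as a homogeneous element of `C^*`. -/
noncomputable abbrev homog {n : ℕ} (φ : Cochain q n) : C q := DirectSum.lof k ℕ (Cochain q) n φ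

/-- `φ = (0, …, 0, e₁, 0, …, 0)`, with `e₁` in position `r` (counted from `0`). -/
def IsUnitAt {n : ℕ} (φ : Cochain q n) (r : Fin (n + 2)) : Prop :=
  ∀ i, φ (ε q n i) = if i = r then e₁ q else 0

/-- `Z^*`: the span of the non-nilpotent cocycles of even degree of the form
`(0, …, 0, e₁, 0, …, 0)` with `e₁` in an even position. -/
noncomputable def ZStar : Submodule k (C q) :=
  Submodule.span k {z | ∃ (n : ℕ) (r : Fin (n + 2)) (φ : Cochain q n),
    Even n ∧ Even (r : ℕ) ∧ IsUnitAt q φ r ∧ dStar q n φ = 0 ∧ ¬ IsNilp q (homog q φ) ∧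
      z = homog q φ}

end Cochains

open MvPolynomial in
/-- The (non-unital) subalgebra `k[x², y²] y²` of `k[x, y]`, where `x = X 0` and `y = X 1`. -/
noncomputable def evenAlg (k : Type*) [Field k] : NonUnitalSubalgebra k (MvPolynomial (Fin 2) k) where
  carrier := {p | ∃ g ∈ Algebra.adjoin k {(X 0 ^ 2 : MvPolynomial (Fin 2) k), X 1 ^ 2},
    p = g * X 1 ^ 2}
  add_mem' := by
    rintro _ _ ⟨g, hg, rfl⟩ ⟨h, hh, rfl⟩
    exact ⟨g + h, add_mem hg hh, (add_mul _ _ _).symm⟩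
  zero_mem' := ⟨0, zero_mem _, (zero_mul _).symm⟩
  mul_mem' := by
    rintro _ _ ⟨g, hg, rfl⟩ ⟨h, hh, rfl⟩
    exact ⟨g * X 1 ^ 2 * h, mul_mem (mul_mem hg (Algebra.subset_adjoin (by simp))) hh, by ring⟩
  smul_mem' := by
    rintro t _ ⟨g, hg, rfl⟩
    exact ⟨t • g, Subalgebra.smul_mem _ hg t, (smul_mul_assoc _ _ _).symm⟩

end HochschildLambda

/-! Everything is read off from the coefficients of `e₁`. A cochain of degree n has a symbol, the
polynomial ∑ uᵢ xⁿ⁻ⁱ yⁱ, where uᵢ is the coefficient of `e₁` in its value at εⁿᵢ, i ≤ n; the value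
in position n + 1 lies in Λ e₂ and has no such coefficient. Every term of the differential carries
an arrow, so coboundaries have symbol 0 (`symbol_eq_zero_of_mem_coboundaries`). If the coefficients
of `e₁` occur only in even degrees and even positions, then for q = ±1 all signs and powers of -q
that matter in the cup product equal 1, and the symbol turns cup products into products of
polynomials (`evenSpan_mul`). As k[x, y] has no nilpotents, a nilpotent element in the span of such
cochains has symbol 0 (`symbol_eq_zero_of_isNilp`).

The cochain with `e₁` in even position r of even degree n has symbol xⁿ⁻ʳ yʳ, so it is never
nilpotent. For r ≥ 2 the a-terms and the b-terms of its differential cancel (`dStar_unitCochain`);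
for r = 0 the last generator contributes ±c ≠ 0. Hence Z^* is spanned by the cases r ≥ 2, and the
symbol carries this family to the distinct monomials that span k[x², y²]y². This gives the
isomorphism, and also that Z^* contains no nonzero coboundary and no nonzero nilpotent element.

A product of two elements of k[x², y²]y² is divisible by y⁴, so the monomials x²ᵐ y² can only come
linearly from generators, and finitely many generators have bounded degree.

For q = 1 and 2 ≠ 0, the coefficients of a and b in the cocycle equation force n and i to be even
whenever uᵢ ≠ 0, and the coefficient of c gives u₀ = 0. So the `e₁`-part of a cocycle of positive
degree lies in Z^*. The rest has values in the radical, where products of three values vanish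
(`mul_mul_eq_zero_of_aug`), so its cup cube is 0. Uniqueness holds because ζ and φ must have the
same symbol.

No basis of Λ_q is needed: seven elements are shown to span it, and coefficients are detected by
algebra maps to the dual numbers and to 2 × 2 matrices. -/

namespace PathAlgebra
-- Universal property of the path algebra
variable {k V A : Type*} [Field k] [Quiver V] [Ring A] [Algebra k A]

/-- The product of the values `X` of the arrows of a path, starting with the value `E` of its
origin. -/
def evalPath (E : V → A) (X : ∀ v w : V, (v ⟶ w) → A) {v : V} : ∀ {w : V}, Quiver.Path v w → A
  | _, .nil => E v
  | _, .cons p x => evalPath E X p * X _ _ x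

variable {E : V → A} {X : ∀ v w : V, (v ⟶ w) → A}

theorem evalPath_mul_vertex (hE : ∀ v, E v * E v = E v) (hX : ∀ v w x, X v w x * E w = X v w x)
    {v w : V} (p : Quiver.Path v w) : evalPath E X p * E w = evalPath E X p := by
  cases p with
  | nil => exact hE v
  | cons p x => rw [evalPath, mul_assoc, hX]

theorem vertex_mul_evalPath (hE : ∀ v, E v * E v = E v) {v w : V} (p : Quiver.Path v w) :
    E v * evalPath E X p = evalPath E X p := by
  induction p with
  | nil => exact hE v
  | cons p x ih => rw [evalPath, ← mul_assoc, ih]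

theorem evalPath_comp (hE : ∀ v, E v * E v = E v) (hX : ∀ v w x, X v w x * E w = X v w x)
    {u v w : V} (p : Quiver.Path u v) (r : Quiver.Path v w) :
    evalPath E X (p.comp r) = evalPath E X p * evalPath E X r := by
  induction r with
  | nil => exact (evalPath_mul_vertex hE hX p).symm
  | cons r x ih => rw [Quiver.Path.comp_cons, evalPath, ih, mul_assoc, evalPath]

variable (k E X) in
/-- The linear extension of `evalPath`. -/
noncomputable def evalLinear : PathAlgebra k V →ₗ[k] A :=
  Finsupp.linearCombination k fun p : AnyPath V => evalPath E X p.path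

theorem evalLinear_ofPath (p : AnyPath V) : evalLinear k E X (ofPath k p) = evalPath E X p.path := by
  rw [evalLinear, ofPath]
  erw [Finsupp.linearCombination_single, one_smul]

theorem evalLinear_mul (hE : ∀ v, E v * E v = E v) (hE' : ∀ v w, v ≠ w → E v * E w = 0)
    (hX : ∀ v w x, X v w x * E w = X v w x) (x y : PathAlgebra k V) :
    evalLinear k E X (x * y) = evalLinear k E X x * evalLinear k E X y := by
  induction x using induction_on with
  | zero => rw [zero_mul', map_zero, zero_mul]
  | add _ _ h h' => rw [add_mul', map_add, h, h', map_add, add_mul]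
  | path s p =>
    induction y using induction_on with
    | zero => rw [mul_zero', map_zero, mul_zero]
    | add _ _ h h' => rw [mul_add', map_add, h, h', map_add, mul_add]
    | path t r =>
      rw [smul_mul', mul_smul', map_smul, map_smul, map_smul, map_smul, ofPath_mul,
        smul_mul_smul_comm, mul_smul]
      congr 2
      obtain ⟨a, b, p⟩ := p
      obtain ⟨c, d, r⟩ := r
      rw [evalLinear_ofPath, evalLinear_ofPath]
      by_cases h : b = c
      · subst h
        rw [concat, dif_pos rfl, evalLinear_ofPath]
        exact evalPath_comp hE hX p r
      -- The idempotents `E b` and `E c` can be inserted between the two factors, and their product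
      -- is 0.
      · rw [concat, dif_neg h, map_zero, ← evalPath_mul_vertex hE hX p,
          ← vertex_mul_evalPath hE r, mul_assoc, ← mul_assoc (E b), hE' _ _ h, zero_mul, mul_zero]

variable [Fintype V]

/-- The algebra map out of the path algebra with given values on vertices and arrows. -/
noncomputable def lift (hE : ∀ v, E v * E v = E v) (hE' : ∀ v w, v ≠ w → E v * E w = 0)
    (hE1 : ∑ v, E v = 1) (hX : ∀ v w x, X v w x * E w = X v w x) : PathAlgebra k V →ₐ[k] A :=
  AlgHom.ofLinearMap (evalLinear k E X)
    (by rw [one_def, map_sum, ← hE1]; exact Finset.sum_congr rfl fun v _ => evalLinear_ofPath _)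
    (evalLinear_mul hE hE' hX)

end PathAlgebra

namespace HochschildLambda

/-! ### Multiplication in Λ_q and a spanning set -/

section Algebra
variable {k : Type*} [Field k] (q : k)

theorem Lambda.mk_mul_eq {x y z : KQ k} (h : x * y = z) :
    Lambda.mk q x * Lambda.mk q y = Lambda.mk q z := by rw [← h, map_mul]

theorem e₁_mul_arrA : e₁ q * arrA q = arrA q :=
  Lambda.mk_mul_eq q (by rw [vertex_mul_arrow, if_pos rfl])
theorem e₁_mul_arrB : e₁ q * arrB q = arrB q :=
  Lambda.mk_mul_eq q (by rw [vertex_mul_arrow, if_pos rfl])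
theorem e₁_mul_arrC : e₁ q * arrC q = arrC q :=
  Lambda.mk_mul_eq q (by rw [vertex_mul_arrow, if_pos rfl])
theorem arrA_mul_e₁ : arrA q * e₁ q = arrA q :=
  Lambda.mk_mul_eq q (by rw [arrow_mul_vertex, if_pos rfl])
theorem arrB_mul_e₁ : arrB q * e₁ q = arrB q :=
  Lambda.mk_mul_eq q (by rw [arrow_mul_vertex, if_pos rfl])
theorem e₁_mul_e₂ : e₁ q * e₂ q = 0 := by
  rw [e₁, e₂, Lambda.mk_mul_eq q (vertex_mul_vertex _ _)]; simp
theorem e₂_mul_e₁ : e₂ q * e₁ q = 0 := by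
  rw [e₁, e₂, Lambda.mk_mul_eq q (vertex_mul_vertex _ _)]; simp
theorem arrC_mul_e₁ : arrC q * e₁ q = 0 := by
  rw [arrC, e₁, Lambda.mk_mul_eq q (arrow_mul_vertex _ _)]; simp

theorem arrC_mul_arrA : arrC q * arrA q = 0 := by
  rw [← e₁_mul_arrA, ← mul_assoc, arrC_mul_e₁, zero_mul]
theorem arrC_mul_arrB : arrC q * arrB q = 0 := by
  rw [← e₁_mul_arrB, ← mul_assoc, arrC_mul_e₁, zero_mul]
theorem arrC_mul_arrC : arrC q * arrC q = 0 := by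
  nth_rw 2 [← e₁_mul_arrC]
  rw [← mul_assoc, arrC_mul_e₁, zero_mul]
theorem e₂_mul_arrA : e₂ q * arrA q = 0 := by
  rw [← e₁_mul_arrA, ← mul_assoc, e₂_mul_e₁, zero_mul]
theorem e₂_mul_arrB : e₂ q * arrB q = 0 := by
  rw [← e₁_mul_arrB, ← mul_assoc, e₂_mul_e₁, zero_mul]
theorem e₂_mul_arrC : e₂ q * arrC q = 0 := by
  rw [← e₁_mul_arrC, ← mul_assoc, e₂_mul_e₁, zero_mul]

theorem Lambda.mk_rel {x y : KQ k} (h : Rel q x y) : Lambda.mk q x = Lambda.mk q y :=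
  RingQuot.mkAlgHom_rel k h

theorem arrA_mul_arrA : arrA q * arrA q = 0 := by
  rw [arrA, ← map_mul, Lambda.mk_rel q .aa, map_zero]
theorem arrB_mul_arrB : arrB q * arrB q = 0 := by
  rw [arrB, ← map_mul, Lambda.mk_rel q .bb, map_zero]
theorem arrA_mul_arrB : arrA q * arrB q = q • (arrB q * arrA q) := by
  rw [arrA, arrB, ← map_mul, Lambda.mk_rel q .ab, map_smul, map_mul]
theorem arrA_mul_arrC : arrA q * arrC q = 0 := by
  rw [arrA, arrC, ← map_mul, Lambda.mk_rel q .ac, map_zero]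

/-- `x = u e₁ + v e₂ + α a + β b + γ ba + δ c + η bc`. -/
def HasCoords (x : Lambda q) (u v α β γ δ η : k) : Prop :=
  x = u • e₁ q + v • e₂ q + α • arrA q + β • arrB q + γ • (arrB q * arrA q) + δ • arrC q +
    η • (arrB q * arrC q)

theorem e₁_mul_of_hasCoords {x : Lambda q} {u v α β γ δ η : k}
    (h : HasCoords q x u v α β γ δ η) : HasCoords q (e₁ q * x) u 0 α β γ δ η := by
  rw [h, HasCoords]
  simp [mul_add, ← mul_assoc, e₁_mul_e₁, e₁_mul_e₂, e₁_mul_arrA, e₁_mul_arrB, e₁_mul_arrC]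

theorem mul_arrA_of_hasCoords {x : Lambda q} {u v α β γ δ η : k}
    (h : HasCoords q x u v α β γ δ η) : HasCoords q (x * arrA q) 0 0 u 0 β 0 0 := by
  rw [h, HasCoords]
  simp [add_mul, mul_assoc, e₁_mul_arrA, e₂_mul_arrA, arrA_mul_arrA, arrC_mul_arrA]

theorem mul_arrB_of_hasCoords {x : Lambda q} {u v α β γ δ η : k}
    (h : HasCoords q x u v α β γ δ η) : HasCoords q (x * arrB q) 0 0 0 u (α * q) 0 0 := by
  have h' : arrB q * (arrB q * arrA q) = 0 := by rw [← mul_assoc, arrB_mul_arrB, zero_mul]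
  rw [h, HasCoords]
  simp [add_mul, mul_assoc, e₁_mul_arrB, e₂_mul_arrB, arrA_mul_arrB, arrB_mul_arrB, arrC_mul_arrB,
    smul_smul, h']

theorem mul_arrC_of_hasCoords {x : Lambda q} {u v α β γ δ η : k}
    (h : HasCoords q x u v α β γ δ η) : HasCoords q (x * arrC q) 0 0 0 0 0 u β := by
  rw [h, HasCoords]
  simp [add_mul, mul_assoc, e₁_mul_arrC, e₂_mul_arrC, arrA_mul_arrC, arrC_mul_arrC]

/-- Right multiplication by an arrow preserves the span of the seven elements, so induction on the
length of a path applies. Uniqueness of coordinates is not claimed; only that of `u` is needed, and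
`aug` supplies it. -/
theorem exists_hasCoords (x : Lambda q) : ∃ u v α β γ δ η, HasCoords q x u v α β γ δ η := by
  obtain ⟨x, rfl⟩ := RingQuot.mkAlgHom_surjective k (Rel q) x
  change ∃ u v α β γ δ η, HasCoords q (Lambda.mk q x) u v α β γ δ η
  induction x using PathAlgebra.induction_on with
  | zero => exact ⟨0, 0, 0, 0, 0, 0, 0, by simp [HasCoords]⟩
  | add x y hx hy =>
    obtain ⟨u, v, α, β, γ, δ, η, h⟩ := hx
    obtain ⟨u', v', α', β', γ', δ', η', h'⟩ := hy
    refine ⟨u + u', v + v', α + α', β + β', γ + γ', δ + δ', η + η', ?_⟩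
    rw [map_add, h, h', HasCoords]
    module
  | path t p =>
    suffices h : ∃ u v α β γ δ η, HasCoords q (Lambda.mk q (PathAlgebra.ofPath k p))
        u v α β γ δ η by
      obtain ⟨u, v, α, β, γ, δ, η, h⟩ := h
      refine ⟨t * u, t * v, t * α, t * β, t * γ, t * δ, t * η, ?_⟩
      rw [map_smul, h, HasCoords]
      module
    obtain ⟨v, w, p⟩ := p
    induction p with
    | nil =>
      cases v
      · exact ⟨1, 0, 0, 0, 0, 0, 0, by simp [HasCoords]; rfl⟩
      · exact ⟨0, 1, 0, 0, 0, 0, 0, by simp [HasCoords]; rfl⟩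
    | @cons w w' p x ih =>
      obtain ⟨u, v, α, β, γ, δ, η, h⟩ := ih
      have e : Lambda.mk q (PathAlgebra.ofPath k ⟨_, _, p.cons x⟩) =
          Lambda.mk q (PathAlgebra.ofPath k ⟨_, _, p⟩) * Lambda.mk q (KQ.arrow k x) := by
        rw [← map_mul, KQ.arrow, PathAlgebra.ofPath_mul, PathAlgebra.concat, dif_pos rfl]
        rfl
      rw [e]
      generalize Lambda.mk q (PathAlgebra.ofPath k ⟨_, _, p⟩) = y at h
      clear p e
      match w, w', x with
      | _, _, .a => exact ⟨_, _, _, _, _, _, _, mul_arrA_of_hasCoords q h⟩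
      | _, _, .b => exact ⟨_, _, _, _, _, _, _, mul_arrB_of_hasCoords q h⟩
      | _, _, .c => exact ⟨_, _, _, _, _, _, _, mul_arrC_of_hasCoords q h⟩

/-! ### Algebra maps out of Λ_q that detect coefficients -/

section lift
variable {A : Type*} [Ring A] [Algebra k A]

/-- The values of the arrows. -/
def arrowVal (a b c : A) : ∀ v w : Vertex, (v ⟶ w) → A
  | _, _, .a => a
  | _, _, .b => b
  | _, _, .c => c

/-- The algebra map out of `Λ_q` with given values on the vertices and arrows. -/
noncomputable def Lambda.lift (E : Vertex → A) (a b c : A) (hE : ∀ v, E v * E v = E v)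
    (hE' : ∀ v w, v ≠ w → E v * E w = 0) (hE1 : ∑ v, E v = 1)
    (h1 : ∀ v, E v * a = if v = .one then a else 0)
    (h2 : ∀ v, E v * b = if v = .one then b else 0)
    (h3 : ∀ v, E v * c = if v = .one then c else 0)
    (ha : a * E .one = a) (hb : b * E .one = b) (hc : c * E .two = c)
    (haa : a * a = 0) (hbb : b * b = 0) (hab : a * b = q • (b * a)) (hac : a * c = 0) :
    Lambda q →ₐ[k] A :=
  RingQuot.liftAlgHom k (s := Rel q)
    ⟨PathAlgebra.lift (E := E) (X := arrowVal a b c) hE hE' hE1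
        (by rintro v w (_ | _ | _) <;> simp only [arrowVal, ha, hb, hc]), by
      have e : ∀ (v w : Vertex) (x : Arrow v w),
          PathAlgebra.lift (k := k) (E := E) (X := arrowVal a b c) hE hE' hE1
            (by rintro v w (_ | _ | _) <;> simp only [arrowVal, ha, hb, hc]) (KQ.arrow k x) =
          arrowVal a b c v w x := by
        intro v w x
        refine (PathAlgebra.evalLinear_ofPath _).trans ?_
        -- The empty path already has value `E v`, so a single arrow is evaluated with this factor
        -- in front.
        change E v * arrowVal a b c v w x = _
        cases x <;> simp [arrowVal, h1, h2, h3]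
      rintro x y (_ | _ | _ | _) <;> simp [e, arrowVal, haa, hbb, hab, hac]⟩

variable (E : Vertex → A) (a b c : A) (hE : ∀ v, E v * E v = E v)
    (hE' : ∀ v w, v ≠ w → E v * E w = 0) (hE1 : ∑ v, E v = 1)
    (h1 : ∀ v, E v * a = if v = .one then a else 0)
    (h2 : ∀ v, E v * b = if v = .one then b else 0)
    (h3 : ∀ v, E v * c = if v = .one then c else 0)
    (ha : a * E .one = a) (hb : b * E .one = b) (hc : c * E .two = c)
    (haa : a * a = 0) (hbb : b * b = 0) (hab : a * b = q • (b * a)) (hac : a * c = 0)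

theorem Lambda.lift_mk (x : KQ k) :
    Lambda.lift q E a b c hE hE' hE1 h1 h2 h3 ha hb hc haa hbb hab hac (Lambda.mk q x) =
      PathAlgebra.evalLinear k E (arrowVal a b c) x :=
  RingQuot.liftAlgHom_mkAlgHom_apply k _ _ _

theorem Lambda.lift_e₁ :
    Lambda.lift q E a b c hE hE' hE1 h1 h2 h3 ha hb hc haa hbb hab hac (e₁ q) = E .one :=
  (Lambda.lift_mk ..).trans (PathAlgebra.evalLinear_ofPath _)

theorem Lambda.lift_e₂ :
    Lambda.lift q E a b c hE hE' hE1 h1 h2 h3 ha hb hc haa hbb hab hac (e₂ q) = E .two :=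
  (Lambda.lift_mk ..).trans (PathAlgebra.evalLinear_ofPath _)

theorem Lambda.lift_arrA :
    Lambda.lift q E a b c hE hE' hE1 h1 h2 h3 ha hb hc haa hbb hab hac (arrA q) = a :=
  (Lambda.lift_mk ..).trans <| (PathAlgebra.evalLinear_ofPath _).trans <|
    (show E .one * a = a by simp [h1])

theorem Lambda.lift_arrB :
    Lambda.lift q E a b c hE hE' hE1 h1 h2 h3 ha hb hc haa hbb hab hac (arrB q) = b :=
  (Lambda.lift_mk ..).trans <| (PathAlgebra.evalLinear_ofPath _).trans <|
    (show E .one * b = b by simp [h2])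

theorem Lambda.lift_arrC :
    Lambda.lift q E a b c hE hE' hE1 h1 h2 h3 ha hb hc haa hbb hab hac (arrC q) = c :=
  (Lambda.lift_mk ..).trans <| (PathAlgebra.evalLinear_ofPath _).trans <|
    (show E .one * c = c by simp [h3])

end lift

/-- The map `Λ_q → k[ε]` with `e₁ ↦ 1`, `a ↦ s ε`, `b ↦ t ε`, `e₂, c ↦ 0`. -/
noncomputable def toDual (s t : k) : Lambda q →ₐ[k] DualNumber k :=
  Lambda.lift q (fun v => if v = .one then 1 else 0) (s • DualNumber.eps) (t • DualNumber.eps) 0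
    (by simp) (by rintro (_ | _) (_ | _) <;> simp)
    (by rw [Finset.sum_ite_eq' Finset.univ Vertex.one]; simp)
    (by simp) (by simp) (by simp) (by simp) (by simp) (by simp) (by simp) (by simp) (by simp)
    (by simp)

theorem toDual_e₁ (s t : k) : toDual q s t (e₁ q) = 1 :=
  (Lambda.lift_e₁ q ..).trans (if_pos rfl)
theorem toDual_e₂ (s t : k) : toDual q s t (e₂ q) = 0 :=
  (Lambda.lift_e₂ q ..).trans (if_neg (by simp))
theorem toDual_arrA (s t : k) : toDual q s t (arrA q) = s • DualNumber.eps := Lambda.lift_arrA q ..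
theorem toDual_arrB (s t : k) : toDual q s t (arrB q) = t • DualNumber.eps := Lambda.lift_arrB q ..
theorem toDual_arrC (s t : k) : toDual q s t (arrC q) = 0 := Lambda.lift_arrC q ..

/-- The augmentation `Λ_q → k` with `e₁ ↦ 1`, and `0` on `e₂` and all arrows. -/
noncomputable def aug : Lambda q →ₐ[k] k :=
  (TrivSqZeroExt.fstHom k k k).comp (toDual q 0 0)

theorem aug_e₁ : aug q (e₁ q) = 1 := by simp [aug, toDual_e₁]
theorem aug_e₂ : aug q (e₂ q) = 0 := by simp [aug, toDual_e₂]
theorem aug_arrA : aug q (arrA q) = 0 := by simp [aug, toDual_arrA]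
theorem aug_arrB : aug q (arrB q) = 0 := by simp [aug, toDual_arrB]
theorem aug_arrC : aug q (arrC q) = 0 := by simp [aug, toDual_arrC]

theorem aug_of_hasCoords {x : Lambda q} {u v α β γ δ η : k}
    (h : HasCoords q x u v α β γ δ η) : aug q x = u := by
  rw [h]
  simp [aug_e₁, aug_e₂, aug_arrA, aug_arrB, aug_arrC]

/-- The map `Λ_q → M₂(k)` with `e₁ ↦ E₀₀`, `e₂ ↦ E₁₁`, `c ↦ E₀₁`, `a, b ↦ 0`. -/
noncomputable def toMat : Lambda q →ₐ[k] Matrix (Fin 2) (Fin 2) k :=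
  Lambda.lift q (fun v => if v = .one then !![1, 0; 0, 0] else !![0, 0; 0, 1]) 0 0 !![0, 1; 0, 0]
    (by rintro (_ | _) <;> simp [funext_iff, Fin.forall_fin_two])
    (by rintro (_ | _) (_ | _) <;> simp [← Matrix.ext_iff, Fin.forall_fin_two])
    (by
      have h : (Finset.univ : Finset Vertex) = {.one, .two} := rfl
      rw [h, Finset.sum_pair (by simp)]
      simp [Matrix.one_fin_two])
    (by simp) (by simp) 
    (by rintro (_ | _) <;> simp [← Matrix.ext_iff, funext_iff, Fin.forall_fin_two]) (by simp) (by simp)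
    (by simp [funext_iff, Fin.forall_fin_two]) (by simp) (by simp) (by simp) (by simp)

theorem toMat_e₁ : toMat q (e₁ q) = !![1, 0; 0, 0] := (Lambda.lift_e₁ q ..).trans (if_pos rfl)
theorem toMat_e₂ : toMat q (e₂ q) = !![0, 0; 0, 1] :=
  (Lambda.lift_e₂ q ..).trans (if_neg (by simp))
theorem toMat_arrA : toMat q (arrA q) = 0 := Lambda.lift_arrA q ..
theorem toMat_arrB : toMat q (arrB q) = 0 := Lambda.lift_arrB q ..
theorem toMat_arrC : toMat q (arrC q) = !![0, 1; 0, 0] := Lambda.lift_arrC q ..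

/-- A product of three elements of `e₁ Λ` without constant term vanishes. -/
theorem mul_mul_eq_zero_of_aug {x y z : Lambda q} (hx : e₁ q * x = x) (hy : e₁ q * y = y)
    (hz : e₁ q * z = z) (hx' : aug q x = 0) (hy' : aug q y = 0) (hz' : aug q z = 0) :
    x * y * z = 0 := by
  -- Left multiplication by `e₁` removes the coordinate of `e₂`, and `aug` that of `e₁`; what
  -- remains is spanned by a, b, ba, c, bc.
  have key : ∀ x : Lambda q, e₁ q * x = x → aug q x = 0 →
      ∃ α β γ δ η, HasCoords q x 0 0 α β γ δ η := by
    intro x hx hx'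
    obtain ⟨u, v, α, β, γ, δ, η, h⟩ := exists_hasCoords q x
    rw [aug_of_hasCoords q h] at hx'
    subst hx'
    exact ⟨α, β, γ, δ, η, hx ▸ e₁_mul_of_hasCoords q h⟩
  obtain ⟨α, β, γ, δ, η, h⟩ := key x hx hx'
  obtain ⟨α', β', γ', δ', η', h'⟩ := key y hy hy'
  obtain ⟨α'', β'', γ'', δ'', η'', h''⟩ := key z hz hz'
  have hA := mul_arrA_of_hasCoords q h
  have hB := mul_arrB_of_hasCoords q h
  have hC := mul_arrC_of_hasCoords q h
  have hBA := mul_arrA_of_hasCoords q hB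
  have hBC := mul_arrC_of_hasCoords q hB
  -- A product of two such elements lies in the span of ba and bc, which right multiplication by any
  -- arrow kills.
  have hxy : HasCoords q (x * y) 0 0 0 0 (α' * β + β' * (α * q)) 0 (δ' * β) := by
    rw [h', HasCoords]
    simp only [mul_add, mul_smul_comm, ← mul_assoc]
    rw [hBA, hBC, hA, hB, hC]
    module
  have gA := mul_arrA_of_hasCoords q hxy
  have gB := mul_arrB_of_hasCoords q hxy
  have gC := mul_arrC_of_hasCoords q hxy
  have gBA := mul_arrA_of_hasCoords q gB
  have gBC := mul_arrC_of_hasCoords q gB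
  rw [h'']
  simp only [mul_add, mul_smul_comm, ← mul_assoc]
  rw [gBA, gBC, gA, gB, gC]
  module

end Algebra
end HochschildLambda

namespace HochschildLambda

/-! ### The coefficients of `e₁` in coboundaries and cocycles -/

section Cochains
variable {k : Type*} [Field k] (q : k)

/-- Multiplication by ε moves the constant term to the coefficient of ε, so the ε-part of an arrow
times x is governed by `aug q x`. -/
theorem fst_toDual (s t : k) (x : Lambda q) : (toDual q s t x).fst = aug q x := by
  obtain ⟨u, v, α, β, γ, δ, η, h⟩ := exists_hasCoords q x
  rw [aug_of_hasCoords q h, h]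
  simp [toDual_e₁, toDual_e₂, toDual_arrA, toDual_arrB, toDual_arrC]

theorem ε'_val (n : ℕ) (i : Fin (n + 2)) : ε' q n i = ε q n i := dif_pos i.2

/-- The εⁿᵢ generate K_n: each component of an element is a multiple of the idempotent in that
position. -/
theorem cochain_ext {n : ℕ} {φ ψ : Cochain q n} (h : ∀ i, φ (ε q n i) = ψ (ε q n i)) : φ = ψ := by
  refine LinearMap.ext fun x => ?_
  have hx : ∀ i : Fin (n + 2), ∃ c : Env q, c • idem q n i = x.1 i := fun i =>
    Submodule.mem_span_singleton.1 (x.2 i trivial)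
  choose c hc using hx
  have e : x = ∑ i, c i • ε q n i := by
    apply Subtype.ext
    funext j
    rw [AddSubmonoidClass.coe_finsetSum, Finset.sum_apply, Finset.sum_eq_single j]
    · simp [ε, ← hc]
    · intro i _ hi
      simp [ε, Pi.single_eq_of_ne hi.symm]
    · simp
  rw [e, map_sum, map_sum]
  exact Finset.sum_congr rfl fun i _ => by rw [map_smul, map_smul, h]

variable {q} in
theorem apply_lact {n : ℕ} (φ : Cochain q n) (x : Lambda q) (m : K q n) :
    φ (lact q x m) = x * φ m := by
  rw [lact, map_smul, Env.mk_smul, mul_one]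

variable {q} in
theorem apply_ract {n : ℕ} (φ : Cochain q n) (x : Lambda q) (m : K q n) :
    φ (ract q m x) = φ m * x := by
  rw [ract, map_smul, Env.mk_smul, one_mul]

variable {q} in
theorem apply_smul {n : ℕ} (φ : Cochain q n) (t : k) (m : K q n) : φ (t • m) = t • φ m :=
  φ.map_smul_of_tower t m

theorem dStar_ε {n : ℕ} (φ : Cochain q n) (i : Fin (n + 3)) :
    dStar q n φ (ε q (n + 1) i) = φ (dGen q n i) :=
  congrArg φ (d_ε q n i)

theorem apply_dGen {n : ℕ} (φ : Cochain q n) (i : ℕ) : φ (dGen q n i) =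
    if i ≤ n + 1 then
      (if i = n + 1 then 0 else arrA q * φ (ε' q n i) +
        ((-1) ^ (n + 1 - i) * q ^ i) • (φ (ε' q n i) * arrA q)) +
      (if i = 0 then 0 else (-q) ^ (n + 1 - i) • (arrB q * φ (ε' q n (i - 1))) +
        (-1 : k) ^ (n + 1) • (φ (ε' q n (i - 1)) * arrB q))
    else if n = 0 then arrC q * φ (ε' q n 1) - φ (ε' q n 0) * arrC q
    else arrA q * φ (ε' q n (n + 1)) + (-1 : k) ^ (n + 1) • (φ (ε' q n 0) * arrC q) := by
  unfold dGen
  split_ifs <;>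
    simp only [map_add, map_sub, map_zero, apply_smul, apply_lact, apply_ract]

/-- Each term of the differential has an arrow as a factor, and `aug` kills arrows. -/
theorem aug_dStar {n : ℕ} (φ : Cochain q n) (i : ℕ) :
    aug q (dStar q n φ (ε' q (n + 1) i)) = 0 := by
  by_cases hi : i < n + 3
  · have h := dStar_ε q φ ⟨i, hi⟩
    rw [← ε'_val] at h
    rw [h, apply_dGen]
    split_ifs <;> simp [aug_arrA, aug_arrB, aug_arrC]
  · simp [ε', hi]

/-- The coefficient of `e₁` in `φ(ε^n_i)`. -/
noncomputable def coeffOne {n : ℕ} (i : ℕ) : Cochain q n →ₗ[k] k where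
  toFun φ := aug q (φ (ε' q n i))
  map_add' _ _ := by simp
  map_smul' _ _ := by simp

theorem coeffOne_apply {n : ℕ} (φ : Cochain q n) (i : ℕ) :
    coeffOne q i φ = aug q (φ (ε' q n i)) := rfl

/-- This is the coefficient of a in the cocycle equation at εⁿ⁺¹ᵢ; `toDual q 1 0` kills b, so only
the two a-terms survive. -/
theorem arrA_coeff_of_dStar_eq_zero {n : ℕ} {φ : Cochain q n} (h : dStar q n φ = 0) {i : ℕ}
    (hi : i ≤ n) : (1 + (-1) ^ (n + 1 - i) * q ^ i) * coeffOne q i φ = 0 := by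
  have h1 := dStar_ε q φ ⟨i, by omega⟩
  rw [h, apply_dGen, LinearMap.zero_apply, if_pos (by simp; omega), if_neg (by simp; omega)] at h1
  have h2 := congrArg (fun x => (toDual q 1 0 x).snd) h1
  split_ifs at h2 <;> simp [toDual_arrA, toDual_arrB, fst_toDual] at h2 <;>
    rw [coeffOne_apply] <;> linear_combination -h2

/-- This is the coefficient of b in the cocycle equation, taken at position i + 1 because the
b-terms of the differential lower the position by one. -/
theorem arrB_coeff_of_dStar_eq_zero {n : ℕ} {φ : Cochain q n} (h : dStar q n φ = 0) {i : ℕ}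
    (hi : i ≤ n) : ((-q) ^ (n - i) + (-1) ^ (n + 1)) * coeffOne q i φ = 0 := by
  have h1 := dStar_ε q φ ⟨i + 1, by omega⟩
  have e : n + 1 - (i + 1) = n - i := by omega
  rw [h, apply_dGen, LinearMap.zero_apply, if_pos (by simp; omega)] at h1
  have h2 := congrArg (fun x => (toDual q 0 1 x).snd) h1
  rw [if_neg (by simp : ¬ i + 1 = 0)] at h2
  simp only [e, Nat.add_sub_cancel] at h2
  split_ifs at h2 <;> simp [toDual_arrA, toDual_arrB, fst_toDual] at h2 <;>
    rw [coeffOne_apply] <;> linear_combination -h2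

theorem toMat_zero_zero (x : Lambda q) : toMat q x 0 0 = aug q x := by
  obtain ⟨u, v, α, β, γ, δ, η, h⟩ := exists_hasCoords q x
  rw [aug_of_hasCoords q h, h]
  simp [toMat_e₁, toMat_e₂, toMat_arrA, toMat_arrB, toMat_arrC]

/-- The last generator contributes ± φ(εⁿ₀)c, whose coefficient of c appears in entry (0, 1) of
`toMat`. In degree 0 the term c φ(ε⁰₁) could cancel it, as it does for the unit e₁ + e₂; `h0`
excludes this. -/
theorem coeffOne_zero_of_dStar_eq_zero {n : ℕ} {φ : Cochain q n} (h : dStar q n φ = 0)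
    (h0 : n = 0 → φ (ε' q n 1) = 0) : coeffOne q 0 φ = 0 := by
  have h1 := dStar_ε q φ (Fin.last (n + 2))
  rw [h, apply_dGen, LinearMap.zero_apply, if_neg (by simp)] at h1
  have h2 := congrArg (fun x => toMat q x 0 1) h1
  rw [coeffOne_apply, ← toMat_zero_zero]
  split_ifs at h2 with hn
  · simpa [h0 hn, toMat_arrC, Matrix.mul_apply] using h2
  · simpa [toMat_arrA, toMat_arrC, Matrix.mul_apply] using h2

/-- The cochain with `e₁` in position `r` and `0` elsewhere. -/
noncomputable def unitCochain (n r : ℕ) : Cochain q n :=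
  liftK q n fun i => if (i : ℕ) = r then e₁ q else 0

theorem unitCochain_ε' {n r : ℕ} (hr : r ≤ n) (i : ℕ) :
    unitCochain q n r (ε' q n i) = if i = r then e₁ q else 0 := by
  by_cases hi : i < n + 2
  · rw [ε', dif_pos hi, unitCochain, liftK_ε]
    by_cases h : i = r
    · subst h
      simp only [if_true, idem]
      rw [orig, term, if_neg (by omega), if_neg (by omega), Env.mk_smul, e₁_mul_e₁, e₁_mul_e₁]
    · simp [h]
  · rw [ε', dif_neg hi, map_zero, if_neg (by omega)]

theorem isUnitAt_unitCochain {n : ℕ} {r : Fin (n + 2)} (hr : (r : ℕ) ≤ n) :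
    IsUnitAt q (unitCochain q n r) r := fun i => by
  simp [← ε'_val, unitCochain_ε' q hr, Fin.ext_iff]

theorem IsUnitAt.eq_unitCochain {n : ℕ} {r : Fin (n + 2)} {φ : Cochain q n} (h : IsUnitAt q φ r)
    (hr : (r : ℕ) ≤ n) : φ = unitCochain q n r :=
  cochain_ext q fun i => (h i).trans (isUnitAt_unitCochain q hr i).symm

theorem coeffOne_unitCochain {n r : ℕ} (hr : r ≤ n) (i : ℕ) :
    coeffOne q i (unitCochain q n r) = if i = r then 1 else 0 := by
  rw [coeffOne_apply, unitCochain_ε' q hr]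
  split_ifs <;> simp [aug_e₁]

variable {q} in
theorem pow_eq_one_of_even (hq : q = 1 ∨ q = -1) {m : ℕ} (hm : Even m) : q ^ m = 1 := by
  rcases hq with rfl | rfl
  · exact one_pow m
  · exact hm.neg_one_pow

variable {q} in
theorem neg_pow_eq_one_of_even (hq : q = 1 ∨ q = -1) {m : ℕ} (hm : Even m) : (-q) ^ m = 1 := by
  rw [hm.neg_pow, pow_eq_one_of_even hq hm]

/-- Only positions r and r + 1 of degree n + 1 see `e₁`. The a-terms cancel in the first because n +
1 - r is odd and q^r = 1, the b-terms in the second because n + 1 is odd and (-q)^(n-r) = 1. -/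
theorem dStar_unitCochain (hq : q = 1 ∨ q = -1) {n r : ℕ} (hn : Even n) (hr : Even r)
    (h2 : 2 ≤ r) (hrn : r ≤ n) : dStar q n (unitCochain q n r) = 0 := by
  refine cochain_ext q fun i => ?_
  rw [dStar_ε, apply_dGen, LinearMap.zero_apply]
  simp only [unitCochain_ε' q hrn]
  have hi := i.2
  generalize (i : ℕ) = i at hi
  -- The boundary of the last generator involves only positions 0 and n + 1, and r is neither.
  rw [if_neg (by omega : ¬ 0 = r), if_neg (by omega : ¬ n + 1 = r)]
  by_cases h : i = r
  · subst h
    have ho : Odd (n + 1 - i) := by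
      rw [Nat.odd_sub (by omega)]; simp [hn, hr]
    rw [if_pos (by omega), if_neg (by omega), if_pos rfl, if_neg (by omega), if_neg (by omega),
      ho.neg_one_pow, pow_eq_one_of_even hq hr, arrA_mul_e₁, e₁_mul_arrA]
    simp
  · rw [if_neg h]
    by_cases h' : i = r + 1
    · subst h'
      have he : Even (n + 1 - (r + 1)) := by
        rw [Nat.add_sub_add_right, Nat.even_sub hrn]; simp [hn, hr]
      simp only [mul_zero, zero_mul, smul_zero, add_zero, ite_self, zero_add]
      rw [if_pos (by omega), if_neg (by omega), Nat.add_sub_cancel, if_pos rfl,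
        neg_pow_eq_one_of_even hq he, hn.add_one.neg_one_pow, arrB_mul_e₁, e₁_mul_arrB]
      simp
    · by_cases h0 : i = 0
      · simp [h0]
      · rw [if_neg (by omega : ¬ i - 1 = r)]
        split_ifs <;> first | omega | simp

end Cochains
end HochschildLambda

namespace HochschildLambda

/-! ### The cup product and the symbol -/

section Cochains
variable {k : Type*} [Field k] (q : k)

theorem cup_smul_left {m n : ℕ} (t : k) (φ : Cochain q m) (μ : Cochain q n) :
    cup q (t • φ) μ = t • cup q φ μ := by
  refine cochain_ext q fun l => ?_
  rw [LinearMap.smul_apply, cup_ε, cup_ε, cupGen, cupGen, smul_comm t, Finset.smul_sum]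
  simp_rw [Finset.smul_sum, LinearMap.smul_apply, smul_mul_assoc, smul_comm t]

theorem cup_smul_right {m n : ℕ} (t : k) (φ : Cochain q m) (μ : Cochain q n) :
    cup q φ (t • μ) = t • cup q φ μ := by
  refine cochain_ext q fun l => ?_
  rw [LinearMap.smul_apply, cup_ε, cup_ε, cupGen, cupGen, smul_comm t, Finset.smul_sum]
  simp_rw [Finset.smul_sum, LinearMap.smul_apply, mul_smul_comm, smul_comm t]

theorem homog_zero (n : ℕ) : homog q (0 : Cochain q n) = 0 :=
  map_zero (DirectSum.lof k ℕ (Cochain q) n)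

theorem homog_add {n : ℕ} (φ ψ : Cochain q n) : homog q (φ + ψ) = homog q φ + homog q ψ :=
  map_add (DirectSum.lof k ℕ (Cochain q) n) φ ψ

theorem homog_smul {n : ℕ} (t : k) (φ : Cochain q n) : homog q (t • φ) = t • homog q φ :=
  map_smul (DirectSum.lof k ℕ (Cochain q) n) t φ

theorem homog_mul_homog {m n : ℕ} (φ : Cochain q m) (μ : Cochain q n) :
    homog q φ * homog q μ = homog q (cup q φ μ) :=
  DirectSum.of_mul_of φ μ

theorem C_induction {P : C q → Prop} (z : C q) (zero : P 0)
    (homog : ∀ n (φ : Cochain q n), P (homog q φ)) (add : ∀ z w, P z → P w → P (z + w)) : P z :=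
  DirectSum.induction_on z zero homog add

instance : IsScalarTower k (C q) (C q) where
  smul_assoc t z w := by
    simp only [smul_eq_mul]
    induction z using C_induction with
    | zero => simp
    | add z z' h h' => rw [smul_add, add_mul, h, h', add_mul, smul_add]
    | homog m φ =>
      induction w using C_induction with
      | zero => simp
      | add w w' h h' => rw [mul_add, h, h', mul_add, smul_add]
      | homog n μ =>
        rw [← homog_smul, homog_mul_homog, homog_mul_homog, cup_smul_left, homog_smul]

instance : SMulCommClass k (C q) (C q) where
  smul_comm t z w := by
    simp only [smul_eq_mul]
    induction z using C_induction with
    | zero => simp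
    | add z z' h h' => rw [add_mul, smul_add, h, h', add_mul]
    | homog m φ =>
      induction w using C_induction with
      | zero => simp
      | add w w' h h' => rw [smul_add, mul_add, mul_add, smul_add, h, h']
      | homog n μ =>
        rw [← homog_smul, homog_mul_homog, homog_mul_homog, cup_smul_right, homog_smul]

/-- The monomial `x^{n-i} y^i`. -/
noncomputable def mono (k : Type*) [Field k] (n i : ℕ) : MvPolynomial (Fin 2) k :=
  .X 0 ^ (n - i) * .X 1 ^ i

theorem mono_mul_mono {m n i j : ℕ} (hi : i ≤ m) (hj : j ≤ n) :
    mono k m i * mono k n j = mono k (m + n) (i + j) := by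
  have e : m + n - (i + j) = (m - i) + (n - j) := by omega
  rw [mono, mono, mono, e, pow_add, pow_add]
  ring

theorem mono_ne_zero (n i : ℕ) : mono k n i ≠ 0 :=
  mul_ne_zero (pow_ne_zero _ (MvPolynomial.X_ne_zero _)) (pow_ne_zero _ (MvPolynomial.X_ne_zero _))

theorem isHomogeneous_mono {n i : ℕ} (hi : i ≤ n) : (mono k n i).IsHomogeneous n := by
  have h := (MvPolynomial.isHomogeneous_X_pow (R := k) (0 : Fin 2) (n - i)).mul
    (MvPolynomial.isHomogeneous_X_pow (R := k) (1 : Fin 2) i)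
  rwa [Nat.sub_add_cancel hi] at h

theorem mono_eq_monomial (n i : ℕ) :
    mono k n i = MvPolynomial.monomial (Finsupp.single 0 (n - i) + Finsupp.single 1 i) 1 := by
  rw [mono, MvPolynomial.X_pow_eq_monomial, MvPolynomial.X_pow_eq_monomial,
    MvPolynomial.monomial_mul, one_mul]

/-- The polynomial `∑ u_i x^{n-i} y^i` of a cochain of degree `n`, where `u_i` is the coefficient
of `e₁` in its value at `ε^n_i`. -/
noncomputable def symbol : C q →ₗ[k] MvPolynomial (Fin 2) k :=
  DirectSum.toModule k ℕ _ fun n => ∑ i ∈ Finset.range (n + 1),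
    (LinearMap.toSpanSingleton k _ (mono k n i)) ∘ₗ coeffOne q i

theorem symbol_homog {n : ℕ} (φ : Cochain q n) :
    symbol q (homog q φ) = ∑ i ∈ Finset.range (n + 1), coeffOne q i φ • mono k n i := by
  rw [symbol, DirectSum.toModule_lof]
  simp

theorem isHomogeneous_symbol {n : ℕ} (φ : Cochain q n) : (symbol q (homog q φ)).IsHomogeneous n := by
  rw [symbol_homog]
  refine MvPolynomial.IsHomogeneous.sum _ _ _ fun i hi => ?_
  rw [MvPolynomial.smul_eq_C_mul]
  have h := (MvPolynomial.isHomogeneous_C (Fin 2) (coeffOne q i φ)).mul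
    (isHomogeneous_mono (k := k) (Finset.mem_range_succ_iff.1 hi))
  rwa [zero_add] at h

theorem symbol_eq_zero_of_mem_coboundaries {z : C q} (hz : z ∈ coboundaries q) :
    symbol q z = 0 := by
  obtain ⟨w, rfl⟩ := hz
  induction w using C_induction with
  | zero => simp
  | add z w h h' => rw [map_add, map_add, h, h', add_zero]
  | homog n φ =>
    rw [totalD, DirectSum.toModule_lof]
    change symbol q (homog q (dStar q n φ)) = 0
    rw [symbol_homog]
    exact Finset.sum_eq_zero fun i _ => by rw [coeffOne_apply, aug_dStar, zero_smul]

/-- `aug` is multiplicative, and for l ≤ m + n the positions m + 1 and n + 1 do not enter the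
comultiplication. -/
theorem coeffOne_cup {m n l : ℕ} (hl : l ≤ m + n) (φ : Cochain q m) (μ : Cochain q n) :
    coeffOne q l (cup q φ μ) = (-1) ^ (m * n) * ∑ i ∈ Finset.range (m + 1),
      ∑ j ∈ Finset.range (n + 1),
        comulCoeff q m n l i j * (coeffOne q i φ * coeffOne q j μ) := by
  have h := cup_ε q φ μ ⟨l, by omega⟩
  rw [← ε'_val] at h
  rw [coeffOne_apply, h, cupGen]
  simp only [map_smul, map_sum, map_mul, smul_eq_mul, ← ε'_val, ← coeffOne_apply]
  congr 1
  rw [Fin.sum_univ_eq_sum_range (fun i => ∑ j : Fin (n + 2),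
    comulCoeff q m n l i j * (coeffOne q i φ * coeffOne q j μ))]
  simp_rw [fun i => Fin.sum_univ_eq_sum_range
    (fun j => comulCoeff q m n l i j * (coeffOne q i φ * coeffOne q j μ)) (n + 2)]
  have h1 : ∀ j, comulCoeff q m n l (m + 1) j = 0 := fun j => by
    rw [comulCoeff, if_pos hl, if_neg (by omega)]
  have h2 : ∀ i, comulCoeff q m n l i (n + 1) = 0 := fun i => by
    rw [comulCoeff, if_pos hl, if_neg (by omega)]
  rw [Finset.sum_range_succ _ (m + 1)]
  simp_rw [Finset.sum_range_succ _ (n + 1)]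
  simp [h1, h2]

/-- The coefficients of `e₁` vanish outside even degrees and even positions. -/
def EvenSupport {n : ℕ} (φ : Cochain q n) : Prop :=
  ∀ i ≤ n, coeffOne q i φ ≠ 0 → Even n ∧ Even i

variable {q} in
-- Evenness of the left factor is enough: m even removes the sign (-1)^(mn), and i even gives
-- (-q)^(i(n-j)) = 1. What is left is the convolution of coefficients.
theorem EvenSupport.coeffOne_cup (hq : q = 1 ∨ q = -1) {m n l : ℕ} (hl : l ≤ m + n)
    {φ : Cochain q m} {μ : Cochain q n} (hφ : EvenSupport q φ) :
    coeffOne q l (cup q φ μ) = ∑ i ∈ Finset.range (m + 1), ∑ j ∈ Finset.range (n + 1),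
      if i + j = l then coeffOne q i φ * coeffOne q j μ else 0 := by
  rw [HochschildLambda.coeffOne_cup q hl, Finset.mul_sum]
  refine Finset.sum_congr rfl fun i hi => ?_
  rw [Finset.mul_sum]
  refine Finset.sum_congr rfl fun j hj => ?_
  rw [Finset.mem_range_succ_iff] at hi hj
  by_cases h0 : coeffOne q i φ * coeffOne q j μ = 0
  · simp [h0]
  · obtain ⟨hm, hi'⟩ := hφ i hi (left_ne_zero_of_mul h0)
    rw [comulCoeff, if_pos hl, (hm.mul_right n).neg_one_pow, one_mul]
    by_cases h : i + j = l
    · rw [if_pos ⟨hi, hj, h⟩, if_pos h, neg_pow_eq_one_of_even hq (hi'.mul_right _), one_mul]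
    · rw [if_neg (by tauto), if_neg h, zero_mul]

variable {q} in
theorem EvenSupport.cup (hq : q = 1 ∨ q = -1) {m n : ℕ}
    {φ : Cochain q m} {μ : Cochain q n} (hφ : EvenSupport q φ) (hμ : EvenSupport q μ) :
    EvenSupport q (cup q φ μ) := by
  intro l hl h
  rw [hφ.coeffOne_cup hq hl] at h
  obtain ⟨i, hi, h⟩ := Finset.exists_ne_zero_of_sum_ne_zero h
  obtain ⟨j, hj, h⟩ := Finset.exists_ne_zero_of_sum_ne_zero h
  rw [Finset.mem_range_succ_iff] at hi hj
  by_cases e : i + j = l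
  · rw [if_pos e] at h
    obtain ⟨h1, h2⟩ := hφ i hi (left_ne_zero_of_mul h)
    obtain ⟨h3, h4⟩ := hμ j hj (right_ne_zero_of_mul h)
    exact ⟨h1.add h3, e ▸ h2.add h4⟩
  · exact absurd (if_neg e) h

variable {q} in
theorem EvenSupport.symbol_cup (hq : q = 1 ∨ q = -1) {m n : ℕ}
    {φ : Cochain q m} {μ : Cochain q n} (hφ : EvenSupport q φ) :
    symbol q (homog q (HochschildLambda.cup q φ μ)) =
      symbol q (homog q φ) * symbol q (homog q μ) := by
  rw [symbol_homog, symbol_homog, symbol_homog, Finset.sum_mul_sum]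
  have h : ∀ l ∈ Finset.range (m + n + 1),
      coeffOne q l (HochschildLambda.cup q φ μ) • mono k (m + n) l =
      ∑ i ∈ Finset.range (m + 1), ∑ j ∈ Finset.range (n + 1),
        if i + j = l then (coeffOne q i φ * coeffOne q j μ) • mono k (m + n) l else 0 := by
    intro l hl
    rw [hφ.coeffOne_cup hq (Finset.mem_range_succ_iff.1 hl), Finset.sum_smul]
    refine Finset.sum_congr rfl fun i _ => ?_
    rw [Finset.sum_smul]
    exact Finset.sum_congr rfl fun j _ => by rw [ite_smul, zero_smul]
  rw [Finset.sum_congr rfl h, Finset.sum_comm]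
  refine Finset.sum_congr rfl fun i hi => ?_
  rw [Finset.sum_comm]
  refine Finset.sum_congr rfl fun j hj => ?_
  rw [Finset.mem_range_succ_iff] at hi hj
  rw [Finset.sum_ite_eq, if_pos (by rw [Finset.mem_range]; omega), smul_mul_smul_comm,
    mono_mul_mono hi hj]

/-- The span of the homogeneous cochains for which the coefficients of `e₁` vanish outside even
degrees and even positions. -/
noncomputable def evenSpan : Submodule k (C q) :=
  Submodule.span k {z | ∃ (n : ℕ) (φ : Cochain q n), EvenSupport q φ ∧ z = homog q φ}

/-! ### Multiplicativity of the symbol, and nilpotence -/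

variable {q}

/-- Bilinear extension of the homogeneous case. The span is larger than `ZStar` so that it also
contains the differences φ - ζ of the last assertion. -/
theorem evenSpan_mul (hq : q = 1 ∨ q = -1) {z w : C q} (hz : z ∈ evenSpan q)
    (hw : w ∈ evenSpan q) : z * w ∈ evenSpan q ∧ symbol q (z * w) = symbol q z * symbol q w := by
  induction hz, hw using Submodule.span_induction₂ with
  | mem_mem z w hz hw =>
    obtain ⟨m, φ, hφ, rfl⟩ := hz
    obtain ⟨n, μ, hμ, rfl⟩ := hw
    rw [homog_mul_homog]
    exact ⟨Submodule.subset_span ⟨_, _, hφ.cup hq hμ, rfl⟩, hφ.symbol_cup hq⟩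
  | zero_left w hw => simp
  | zero_right z hz => simp
  | add_left x y z _ _ _ h h' =>
    rw [add_mul, map_add, map_add, add_mul, h.2, h'.2]
    exact ⟨add_mem h.1 h'.1, rfl⟩
  | add_right x y z _ _ _ h h' =>
    rw [mul_add, map_add, map_add, mul_add, h.2, h'.2]
    exact ⟨add_mem h.1 h'.1, rfl⟩
  | smul_left t x y _ _ h =>
    rw [smul_mul_assoc, map_smul, map_smul, smul_mul_assoc, h.2]
    exact ⟨Submodule.smul_mem _ t h.1, rfl⟩
  | smul_right t x y _ _ h =>
    rw [mul_smul_comm, map_smul, map_smul, mul_smul_comm, h.2]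
    exact ⟨Submodule.smul_mem _ t h.1, rfl⟩

theorem evenSpan_cupPow (hq : q = 1 ∨ q = -1) {z : C q} (hz : z ∈ evenSpan q) (m : ℕ) :
    cupPow q z m ∈ evenSpan q ∧ symbol q (cupPow q z m) = symbol q z ^ (m + 1) := by
  induction m with
  | zero => exact ⟨hz, (pow_one _).symm⟩
  | succ m ih =>
    have h := evenSpan_mul hq ih.1 hz
    exact ⟨h.1, by rw [cupPow, h.2, ih.2, pow_succ _ (m + 1)]⟩

/-- A power of the symbol is the symbol of a coboundary, hence 0, and k[x, y] is a domain. -/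
theorem symbol_eq_zero_of_isNilp (hq : q = 1 ∨ q = -1) {z : C q} (hz : z ∈ evenSpan q)
    (h : IsNilp q z) : symbol q z = 0 := by
  obtain ⟨m, hm⟩ := h
  have h1 := symbol_eq_zero_of_mem_coboundaries q hm
  rw [(evenSpan_cupPow hq hz m).2] at h1
  exact pow_eq_zero_iff (Nat.succ_ne_zero m) |>.1 h1

theorem evenSupport_unitCochain {n r : ℕ} (hn : Even n) (hr : Even r) (hrn : r ≤ n) :
    EvenSupport q (unitCochain q n r) := fun i _ h => by
  rw [coeffOne_unitCochain q hrn] at h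
  by_cases e : i = r
  · exact ⟨hn, e ▸ hr⟩
  · exact absurd (if_neg e) h

theorem symbol_unitCochain {n r : ℕ} (hrn : r ≤ n) :
    symbol q (homog q (unitCochain q n r)) = mono k n r := by
  rw [symbol_homog, Finset.sum_eq_single r]
  · simp [coeffOne_unitCochain q hrn]
  · intro i _ hi
    rw [coeffOne_unitCochain q hrn, if_neg hi, zero_smul]
  · intro h
    simp at h
    omega

theorem not_isNilp_unitCochain (hq : q = 1 ∨ q = -1) {n r : ℕ} (hn : Even n) (hr : Even r)
    (hrn : r ≤ n) : ¬ IsNilp q (homog q (unitCochain q n r)) := fun h => by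
  have h1 := symbol_eq_zero_of_isNilp hq
    (Submodule.subset_span ⟨n, _, evenSupport_unitCochain hn hr hrn, rfl⟩) h
  rw [symbol_unitCochain hrn] at h1
  exact mono_ne_zero n r h1

theorem two_le_of_dStar_unitCochain {n r : ℕ} (hr : Even r) (hrn : r ≤ n)
    (h : dStar q n (unitCochain q n r) = 0) : 2 ≤ r := by
  by_contra h2
  obtain rfl : r = 0 := by
    obtain ⟨t, rfl⟩ := hr
    omega
  have h1 := coeffOne_zero_of_dStar_eq_zero q h fun _ => by
    rw [unitCochain_ε' q hrn, if_neg one_ne_zero]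
  rw [coeffOne_unitCochain q hrn, if_pos rfl] at h1
  exact one_ne_zero h1

/-- The equality holds for cochains, not only up to coboundaries, which is why Z^* itself is closed
under the cup product. -/
theorem unitCochain_cup (hq : q = 1 ∨ q = -1) {m n r s : ℕ} (hm : Even m) (hr : Even r)
    (hrm : r ≤ m) (hsn : s ≤ n) (hn : n ≠ 0) :
    cup q (unitCochain q m r) (unitCochain q n s) = unitCochain q (m + n) (r + s) := by
  refine cochain_ext q fun l => ?_
  rw [cup_ε, cupGen, Finset.sum_eq_single ⟨r, by omega⟩, Finset.sum_eq_single ⟨s, by omega⟩]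
  · simp only [← ε'_val, unitCochain_ε' q hrm, unitCochain_ε' q hsn,
      unitCochain_ε' q (add_le_add hrm hsn)]
    rw [if_true, e₁_mul_e₁, (hm.mul_right n).neg_one_pow, one_smul, comulCoeff]
    by_cases hl : (l : ℕ) ≤ m + n
    · rw [if_pos hl]
      by_cases h : (l : ℕ) = r + s
      · rw [if_pos h, if_pos ⟨hrm, hsn, h.symm⟩, neg_pow_eq_one_of_even hq (hr.mul_right _),
          one_smul]
      · rw [if_neg h, if_neg (fun h' => h h'.2.2.symm), zero_smul]
    -- In position m + n + 1 the right factor enters only through its position n + 1, and s ≤ n.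
    · rw [if_neg hl, if_neg hn, if_neg (by simp; omega), if_neg (by omega), zero_smul]
  · intro j _ hj
    have h : unitCochain q n s (ε q n j) = 0 := by
      rw [← ε'_val, unitCochain_ε' q hsn, if_neg (fun e => hj (Fin.ext e))]
    rw [h, mul_zero, smul_zero]
  · simp
  · intro i _ hi
    have h : unitCochain q m r (ε q m i) = 0 := by
      rw [← ε'_val, unitCochain_ε' q hrm, if_neg (fun e => hi (Fin.ext e))]
    exact Finset.sum_eq_zero fun j _ => by rw [h, zero_mul, smul_zero]
  · simp

/-! ### Spanning cocycles of Z^* -/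

/-- Non-nilpotence is automatic, and the cocycle condition amounts to 2 ≤ r. The last position n + 1
is odd, so it does not occur. -/
theorem ZStar_eq_span (hq : q = 1 ∨ q = -1) : ZStar q = Submodule.span k {z | ∃ n r : ℕ,
    Even n ∧ Even r ∧ 2 ≤ r ∧ r ≤ n ∧ z = homog q (unitCochain q n r)} := by
  rw [ZStar]
  congr 1
  ext z
  constructor
  · rintro ⟨n, r, φ, hn, hr, hφ, hd, -, rfl⟩
    have hrn : (r : ℕ) ≤ n := by
      obtain ⟨s, hs⟩ := hn
      obtain ⟨t, ht⟩ := hr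
      have := r.2
      omega
    obtain rfl := hφ.eq_unitCochain q hrn
    exact ⟨n, r, hn, hr, two_le_of_dStar_unitCochain hr hrn hd, hrn, rfl⟩
  · rintro ⟨n, r, hn, hr, h2, hrn, rfl⟩
    exact ⟨n, ⟨r, by omega⟩, _, hn, hr, isUnitAt_unitCochain q (r := ⟨r, by omega⟩) hrn,
      dStar_unitCochain q hq hn hr h2 hrn, not_isNilp_unitCochain hq hn hr hrn, rfl⟩

theorem homog_unitCochain_mem_ZStar (hq : q = 1 ∨ q = -1) {n r : ℕ} (hn : Even n) (hr : Even r)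
    (h2 : 2 ≤ r) (hrn : r ≤ n) : homog q (unitCochain q n r) ∈ ZStar q := by
  rw [ZStar_eq_span hq]
  exact Submodule.subset_span ⟨n, r, hn, hr, h2, hrn, rfl⟩

theorem ZStar_induction (hq : q = 1 ∨ q = -1) {P : C q → Prop}
    (unit : ∀ n r, Even n → Even r → 2 ≤ r → r ≤ n → P (homog q (unitCochain q n r)))
    (zero : P 0) (add : ∀ z w, P z → P w → P (z + w)) (smul : ∀ (t : k) z, P z → P (t • z))
    {z : C q} (hz : z ∈ ZStar q) : P z := by
  rw [ZStar_eq_span hq] at hz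
  induction hz using Submodule.span_induction with
  | mem z hz =>
    obtain ⟨n, r, hn, hr, h2, hrn, rfl⟩ := hz
    exact unit n r hn hr h2 hrn
  | zero => exact zero
  | add z w _ _ h h' => exact add z w h h'
  | smul t z _ h => exact smul t z h

theorem ZStar_le_evenSpan (hq : q = 1 ∨ q = -1) : ZStar q ≤ evenSpan q := fun _ hz =>
  ZStar_induction hq (P := (· ∈ evenSpan q))
    (fun _ _ hn hr _ hrn =>
      Submodule.subset_span ⟨_, _, evenSupport_unitCochain hn hr hrn, rfl⟩)
    (zero_mem _) (fun _ _ => add_mem) (fun t _ => Submodule.smul_mem _ t) hz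

theorem ZStar_mul_mem (hq : q = 1 ∨ q = -1) {z w : C q} (hz : z ∈ ZStar q) (hw : w ∈ ZStar q) :
    z * w ∈ ZStar q := by
  refine ZStar_induction hq (P := fun z => z * w ∈ ZStar q) (fun m r hm hr h2 hrm => ?_)
    (by simp) (fun z z' h h' => by rw [add_mul]; exact add_mem h h')
    (fun t z h => by rw [smul_mul_assoc]; exact Submodule.smul_mem _ t h) hz
  refine ZStar_induction hq (P := fun w => homog q (unitCochain q m r) * w ∈ ZStar q)
    (fun n s hn hs h2' hsn => ?_)
    (by simp) (fun z z' h h' => by rw [mul_add]; exact add_mem h h')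
    (fun t z h => by rw [mul_smul_comm]; exact Submodule.smul_mem _ t h) hw
  rw [homog_mul_homog, unitCochain_cup hq hm hr hrm hsn (by omega)]
  exact homog_unitCochain_mem_ZStar hq (hm.add hn) (hr.add hs) (by omega) (by omega)

theorem ZStar_homog_apply_mem (hq : q = 1 ∨ q = -1) {z : C q} (hz : z ∈ ZStar q) (n : ℕ) :
    homog q (z n) ∈ ZStar q := by
  refine ZStar_induction hq (P := fun z => homog q (z n) ∈ ZStar q)
    (fun m r hm hr h2 hrm => ?_) (by simp)
    (fun z w h h' => by rw [DirectSum.add_apply, homog_add]; exact add_mem h h')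
    (fun t z h => by rw [DirectSum.smul_apply, homog_smul]; exact Submodule.smul_mem _ t h) hz
  by_cases h : m = n
  · subst h
    rw [homog, DirectSum.lof_apply]
    exact homog_unitCochain_mem_ZStar hq hm hr h2 hrm
  · have e : homog q (unitCochain q m r) n = 0 := DirectSum.of_eq_of_ne _ _ _ (Ne.symm h)
    rw [e]
    exact (homog_zero q n).symm ▸ zero_mem (ZStar q)

variable (q) in
/-- The linear map with `x^{n-i} y^i ↦ (0, …, 0, e₁, 0, …, 0)`, with `e₁` in position `i` of
degree `n`. -/
noncomputable def ofSymbol : MvPolynomial (Fin 2) k →ₗ[k] C q :=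
  (MvPolynomial.basisMonomials (Fin 2) k).constr k fun s =>
    homog q (unitCochain q (s 0 + s 1) (s 1))

theorem ofSymbol_mono {n r : ℕ} (hrn : r ≤ n) :
    ofSymbol q (mono k n r) = homog q (unitCochain q n r) := by
  have h := (MvPolynomial.basisMonomials (Fin 2) k).constr_basis k
    (fun s => homog q (unitCochain q (s 0 + s 1) (s 1)))
    (Finsupp.single 0 (n - r) + Finsupp.single 1 r)
  rw [MvPolynomial.coe_basisMonomials] at h
  rw [mono_eq_monomial]
  refine h.trans ?_
  have e0 : (Finsupp.single (0 : Fin 2) (n - r) + Finsupp.single 1 r : Fin 2 →₀ ℕ) 0 = n - r := by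
    rw [Finsupp.add_apply]; simp
  have e1 : (Finsupp.single (0 : Fin 2) (n - r) + Finsupp.single 1 r : Fin 2 →₀ ℕ) 1 = r := by
    rw [Finsupp.add_apply]; simp
  rw [e0, e1, Nat.sub_add_cancel hrn]

/-- A left inverse of the symbol on Z^* yields injectivity without a separate proof that the
spanning cocycles are independent. -/
theorem ofSymbol_symbol (hq : q = 1 ∨ q = -1) {z : C q} (hz : z ∈ ZStar q) :
    ofSymbol q (symbol q z) = z :=
  ZStar_induction hq (P := fun z => ofSymbol q (symbol q z) = z)
    (fun n r _ _ _ hrn => by rw [symbol_unitCochain hrn, ofSymbol_mono hrn]) (by simp)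
    (fun z w h h' => by rw [map_add, map_add, h, h']) (fun t z h => by rw [map_smul, map_smul, h])
    hz

end Cochains
end HochschildLambda

namespace HochschildLambda

/-! ### The algebra k[x², y²]y² -/

section Polynomials
variable {k : Type*} [Field k]

theorem mono_mem_evenAlg {n r : ℕ} (hn : Even n) (hr : Even r) (h2 : 2 ≤ r) (hrn : r ≤ n) :
    mono k n r ∈ evenAlg k := by
  obtain ⟨s, rfl⟩ : ∃ s, r = 2 * (s + 1) := by
    obtain ⟨t, rfl⟩ := hr
    exact ⟨t - 1, by omega⟩
  obtain ⟨t, rfl⟩ : ∃ t, n = 2 * (s + 1) + 2 * t := by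
    obtain ⟨m, rfl⟩ := hn
    exact ⟨m - (s + 1), by omega⟩
  refine ⟨(.X 0 ^ 2) ^ t * (.X 1 ^ 2) ^ s, mul_mem (pow_mem (Algebra.subset_adjoin (by simp)) _)
    (pow_mem (Algebra.subset_adjoin (by simp)) _), ?_⟩
  rw [mono, Nat.add_sub_cancel_left]
  ring

theorem evenAlg_le_span : (evenAlg k).toSubmodule ≤ Submodule.span k {p | ∃ n r : ℕ,
    Even n ∧ Even r ∧ 2 ≤ r ∧ r ≤ n ∧ p = mono k n r} := by
  rintro _ ⟨g, hg, rfl⟩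
  rw [← Subalgebra.mem_toSubmodule, Algebra.adjoin_eq_span] at hg
  induction hg using Submodule.span_induction with
  | mem g hg =>
    obtain ⟨s, t, rfl⟩ := (Submonoid.mem_closure_pair _ _ _).1 hg
    -- Here x²ˢ y²ᵗ is multiplied by y², which gives degree 2(s + t + 1) and exponent 2(t + 1) of y.
    refine Submodule.subset_span ⟨2 * (s + t + 1), 2 * (t + 1), by simp, by simp, by omega,
      by omega, ?_⟩
    have e : 2 * (s + t + 1) - 2 * (t + 1) = 2 * s := by omega
    rw [mono, e]
    ring
  | zero => simp
  | add g g' _ _ h h' => rw [add_mul]; exact add_mem h h'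
  | smul t g _ h => rw [smul_mul_assoc]; exact Submodule.smul_mem _ t h

/-- The product is divisible by y⁴, and xⁿ y² is not. -/
theorem coeff_mul_X_sq_mul_X_sq (g h : MvPolynomial (Fin 2) k) (n : ℕ) :
    MvPolynomial.coeff (Finsupp.single 0 n + Finsupp.single 1 2)
      (g * .X 1 ^ 2 * (h * .X 1 ^ 2)) = 0 := by
  have e : g * MvPolynomial.X 1 ^ 2 * (h * MvPolynomial.X 1 ^ 2) =
      g * h * MvPolynomial.monomial (Finsupp.single 1 4) 1 := by
    rw [← MvPolynomial.X_pow_eq_monomial]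
    ring
  rw [e, MvPolynomial.coeff_mul_monomial', if_neg]
  intro hle
  have := hle 1
  simp at this

theorem evenAlg_not_fg : ¬ ∃ s : Finset (MvPolynomial (Fin 2) k),
    NonUnitalAlgebra.adjoin k (s : Set (MvPolynomial (Fin 2) k)) = evenAlg k := by
  rintro ⟨s, hs⟩
  set M := s.sup MvPolynomial.totalDegree with hM
  -- For generators this is the degree bound M; for products it holds for every n by divisibility by
  -- y⁴, whatever the factors are.
  have key : ∀ p ∈ NonUnitalAlgebra.adjoin k (s : Set (MvPolynomial (Fin 2) k)),
      ∀ n, M < n → MvPolynomial.coeff (Finsupp.single 0 n + Finsupp.single 1 2) p = 0 := by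
    intro p hp
    induction hp using NonUnitalAlgebra.adjoin_induction with
    | mem p hp =>
      intro n hn
      refine MvPolynomial.coeff_eq_zero_of_totalDegree_lt
        ((Finset.le_sup (f := MvPolynomial.totalDegree) hp).trans_lt (hn.trans_le ?_))
      have h := Finsupp.degree_apply (Finsupp.single (0 : Fin 2) n + Finsupp.single 1 2)
      rw [map_add, Finsupp.degree_single, Finsupp.degree_single] at h
      exact (Nat.le_add_right n 2).trans h.le
    | zero => simp
    | add p p' _ _ h h' => intro n hn; rw [MvPolynomial.coeff_add, h n hn, h' n hn, add_zero]
    | mul p p' hp hp' _ _ =>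
      intro n _
      rw [hs] at hp hp'
      obtain ⟨g, -, rfl⟩ := hp
      obtain ⟨g', -, rfl⟩ := hp'
      exact coeff_mul_X_sq_mul_X_sq g g' n
    | smul t p _ h => intro n hn; rw [MvPolynomial.coeff_smul, h n hn, smul_zero]
  -- The monomial x^(2(M+1)) y² lies in the algebra but violates `key`.
  have h := mono_mem_evenAlg (k := k) (n := 2 * (M + 1) + 2) (r := 2) (by simp [Nat.even_add])
    (by simp) le_rfl (by omega)
  rw [← hs] at h
  have h1 := key _ h (2 * (M + 1)) (by omega)
  rw [mono_eq_monomial, Nat.add_sub_cancel, MvPolynomial.coeff_monomial, if_pos rfl] at h1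
  exact one_ne_zero h1

end Polynomials

/-! ### The isomorphism from Z^* onto k[x², y²]y² -/

section Cochains
variable {k : Type*} [Field k] {q : k}

theorem symbol_mem_evenAlg (hq : q = 1 ∨ q = -1) {z : C q} (hz : z ∈ ZStar q) :
    symbol q z ∈ evenAlg k :=
  ZStar_induction hq (P := fun z => symbol q z ∈ evenAlg k)
    (fun n r hn hr h2 hrn => by
      rw [symbol_unitCochain hrn]
      exact mono_mem_evenAlg hn hr h2 hrn)
    (by rw [map_zero]; exact zero_mem _)
    (fun z w h h' => by rw [map_add]; exact add_mem h h')
    (fun t z h => by rw [map_smul]; exact (evenAlg k).toSubmodule.smul_mem t h) hz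

theorem exists_symbol_eq (hq : q = 1 ∨ q = -1) {p : MvPolynomial (Fin 2) k}
    (hp : p ∈ evenAlg k) : ∃ z ∈ ZStar q, symbol q z = p := by
  have h : (evenAlg k).toSubmodule ≤ (ZStar q).map (symbol q) := by
    refine evenAlg_le_span.trans (Submodule.span_le.2 ?_)
    rintro _ ⟨n, r, hn, hr, h2, hrn, rfl⟩
    exact ⟨_, homog_unitCochain_mem_ZStar hq hn hr h2 hrn, symbol_unitCochain hrn⟩
  exact h hp

theorem eq_of_symbol_eq (hq : q = 1 ∨ q = -1) {z w : C q} (hz : z ∈ ZStar q) (hw : w ∈ ZStar q)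
    (h : symbol q z = symbol q w) : z = w := by
  rw [← ofSymbol_symbol hq hz, h, ofSymbol_symbol hq hw]

theorem eq_zero_of_symbol_eq_zero (hq : q = 1 ∨ q = -1) {z : C q} (hz : z ∈ ZStar q)
    (h : symbol q z = 0) : z = 0 :=
  eq_of_symbol_eq hq hz (zero_mem _) (h.trans (map_zero _).symm)

/-- `Z^*` as a subalgebra. -/
noncomputable def ZAlg (hq : q = 1 ∨ q = -1) : NonUnitalSubalgebra k (C q) where
  __ := ZStar q
  mul_mem' := ZStar_mul_mem hq

/-- The restriction of `symbol` to `Z^*`. -/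
noncomputable def symbolHom (hq : q = 1 ∨ q = -1) : ZAlg hq →ₙₐ[k] MvPolynomial (Fin 2) k where
  toFun z := symbol q z.1
  map_smul' t z := map_smul (symbol q) t z.1
  map_zero' := map_zero (symbol q)
  map_add' z w := map_add (symbol q) z.1 w.1
  map_mul' z w := (evenSpan_mul hq (ZStar_le_evenSpan hq z.2) (ZStar_le_evenSpan hq w.2)).2

theorem range_symbolHom (hq : q = 1 ∨ q = -1) :
    NonUnitalAlgHom.range (symbolHom hq) = evenAlg k := by
  ext p
  constructor
  · rintro ⟨z, rfl⟩
    exact symbol_mem_evenAlg hq z.2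
  · intro hp
    obtain ⟨z, hz, rfl⟩ := exists_symbol_eq hq hp
    exact ⟨⟨z, hz⟩, rfl⟩

/-! ### Cocycles modulo nilpotent ones for q = 1 -/

/-- Where uᵢ ≠ 0 both scalars must vanish: 1 + (-1)^(n+1-i) = 0 forces n - i even, and then 1 +
(-1)^(n+1) = 0 forces n even. Otherwise 2 would be 0 in k. -/
theorem evenSupport_of_dStar_eq_zero (h2 : (2 : k) ≠ 0) {n : ℕ} {φ : Cochain (1 : k) n}
    (h : dStar 1 n φ = 0) : EvenSupport 1 φ := by
  intro i hi h0
  have hA := (mul_eq_zero.1 (arrA_coeff_of_dStar_eq_zero 1 h hi)).resolve_right h0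
  have hB := (mul_eq_zero.1 (arrB_coeff_of_dStar_eq_zero 1 h hi)).resolve_right h0
  rw [one_pow, mul_one] at hA
  have h3 : (1 : k) + 1 ≠ 0 := by rwa [one_add_one_eq_two]
  have h4 : (-1 : k) + -1 ≠ 0 := by rw [← neg_add]; exact neg_ne_zero.2 h3
  rcases Nat.even_or_odd (n - i) with he | ho
  · rcases Nat.even_or_odd n with hn | hn
    · refine ⟨hn, ?_⟩
      rw [Nat.even_sub hi] at he
      exact he.1 hn
    · rw [he.neg_one_pow, hn.add_one.neg_one_pow] at hB
      exact absurd hB h3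
  · rw [Nat.sub_add_comm hi, ho.add_one.neg_one_pow] at hA
    exact absurd hA h3

/-- In positive degree every generator has origin e₁, and the value in position n + 1 lies in Λ e₂.
So all values are in e₁Λ with zero augmentation, and each summand contains a product of three of
them. -/
theorem cup_cup_eq_zero {n : ℕ} {φ : Cochain q n} (hn : 0 < n)
    (h : ∀ i ≤ n, coeffOne q i φ = 0) : cup q (cup q φ φ) φ = 0 := by
  have he : ∀ i, e₁ q * φ (ε q n i) = φ (ε q n i) := fun i => by
    have h1 := orig_mul_ε q φ i
    rwa [orig, if_neg (by omega)] at h1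
  have ha : ∀ i, aug q (φ (ε q n i)) = 0 := fun i => by
    rcases Nat.lt_or_ge n i with hi | hi
    · have h1 := congrArg (aug q) (ε_mul_term q φ i)
      rw [term, if_pos (by omega), map_mul, aug_e₂, mul_zero] at h1
      exact h1.symm
    · rw [← ε'_val]
      exact h i hi
  refine cochain_ext q fun l => ?_
  rw [cup_ε, cupGen, LinearMap.zero_apply]
  refine (congrArg _ (Finset.sum_eq_zero fun i _ => Finset.sum_eq_zero fun j _ => ?_)).trans
    (smul_zero _)
  rw [cup_ε, cupGen, smul_mul_assoc, Finset.sum_mul]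
  refine (congrArg _ (congrArg _ (Finset.sum_eq_zero fun i' _ => ?_))).trans
    ((congrArg _ (smul_zero _)).trans (smul_zero _))
  rw [Finset.sum_mul]
  refine Finset.sum_eq_zero fun j' _ => ?_
  rw [smul_mul_assoc, mul_mul_eq_zero_of_aug q (he _) (he _) (he _) (ha _) (ha _) (ha _),
    smul_zero]

theorem isNilp_of_coeffOne_eq_zero {n : ℕ} {φ : Cochain q n} (hn : 0 < n)
    (h : ∀ i ≤ n, coeffOne q i φ = 0) : IsNilp q (homog q φ) := by
  refine ⟨2, ?_⟩
  rw [cupPow, cupPow, cupPow, homog_mul_homog, homog_mul_homog, cup_cup_eq_zero hn h, homog_zero]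
  exact zero_mem _

theorem homog_sub {n : ℕ} (φ ψ : Cochain q n) : homog q (φ - ψ) = homog q φ - homog q ψ :=
  map_sub (DirectSum.lof k ℕ (Cochain q) n) φ ψ

/-- The part of a cochain with values in `k e₁`. -/
noncomputable def unitPart {n : ℕ} (φ : Cochain q n) : Cochain q n :=
  ∑ i ∈ Finset.range (n + 1), coeffOne q i φ • unitCochain q n i

theorem coeffOne_unitPart {n : ℕ} (φ : Cochain q n) {i : ℕ} (hi : i ≤ n) :
    coeffOne q i (unitPart φ) = coeffOne q i φ := by
  rw [unitPart, map_sum, Finset.sum_eq_single i]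
  · rw [map_smul, coeffOne_unitCochain q hi, if_pos rfl, smul_eq_mul, mul_one]
  · intro j hj hji
    rw [map_smul, coeffOne_unitCochain q (Finset.mem_range_succ_iff.1 hj), if_neg hji.symm,
      smul_zero]
  · intro h
    simp at h
    omega

/-- The coefficients of a and b leave only even positions, and that of c removes position 0. -/
theorem homog_unitPart_mem_ZStar (h2 : (2 : k) ≠ 0) {n : ℕ} (hn : 0 < n) {φ : Cochain (1 : k) n}
    (h : dStar 1 n φ = 0) : homog 1 (unitPart φ) ∈ ZStar (1 : k) := by
  have e : homog 1 (unitPart φ) =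
      ∑ i ∈ Finset.range (n + 1), homog 1 (coeffOne 1 i φ • unitCochain 1 n i) :=
    map_sum (DirectSum.lof k ℕ (Cochain (1 : k)) n) _ _
  rw [e]
  refine sum_mem fun i hi => ?_
  rw [Finset.mem_range_succ_iff] at hi
  rw [homog_smul]
  by_cases h0 : coeffOne 1 i φ = 0
  · rw [h0, zero_smul]
    exact zero_mem _
  · obtain ⟨hn', hi'⟩ := evenSupport_of_dStar_eq_zero h2 h i hi h0
    refine Submodule.smul_mem _ _ (homog_unitCochain_mem_ZStar (.inl rfl) hn' hi' ?_ hi)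
    by_contra hlt
    obtain rfl : i = 0 := by
      obtain ⟨t, rfl⟩ := hi'
      omega
    exact h0 (coeffOne_zero_of_dStar_eq_zero 1 h fun h' => absurd h' hn.ne')

theorem existsUnique_isNilp_sub (h2 : (2 : k) ≠ 0) {n : ℕ} (hn : 0 < n) {φ : Cochain (1 : k) n}
    (h : dStar 1 n φ = 0) : ∃! ζ : Cochain (1 : k) n, homog 1 ζ ∈ ZStar (1 : k) ∧
      IsNilp 1 (homog 1 φ - homog 1 ζ) := by
  have hq : (1 : k) = 1 ∨ (1 : k) = -1 := .inl rfl
  -- The difference φ - ζ lies in `evenSpan`, so its nilpotence forces its symbol to vanish; this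
  -- determines the symbol of ζ, hence ζ.
  have hsymb : ∀ ζ : Cochain (1 : k) n, homog 1 ζ ∈ ZStar (1 : k) →
      IsNilp 1 (homog 1 φ - homog 1 ζ) → symbol 1 (homog 1 ζ) = symbol 1 (homog 1 φ) := by
    intro ζ hζ hnil
    have hφ : homog 1 φ ∈ evenSpan (1 : k) :=
      Submodule.subset_span ⟨n, φ, evenSupport_of_dStar_eq_zero h2 h, rfl⟩
    have e : homog 1 φ - homog 1 ζ = homog 1 φ + (-1 : k) • homog 1 ζ := by
      rw [← homog_smul, ← homog_add, ← homog_sub]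
      congr 1
      refine LinearMap.ext fun x => ?_
      rw [LinearMap.sub_apply, LinearMap.add_apply, LinearMap.smul_apply, neg_one_smul,
        sub_eq_add_neg]
    rw [e] at hnil
    have h1 := symbol_eq_zero_of_isNilp hq
      (add_mem hφ (Submodule.smul_mem _ _ (ZStar_le_evenSpan hq hζ))) hnil
    rw [map_add, map_smul, neg_one_smul, ← sub_eq_add_neg, sub_eq_zero] at h1
    exact h1.symm
  have hnil : IsNilp 1 (homog 1 φ - homog 1 (unitPart φ)) := by
    rw [← homog_sub]
    refine isNilp_of_coeffOne_eq_zero hn fun i hi => ?_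
    rw [map_sub, coeffOne_unitPart φ hi, sub_self]
  have hmem := homog_unitPart_mem_ZStar h2 hn h
  refine ⟨unitPart φ, ⟨hmem, hnil⟩, fun ζ ⟨hζ, hζ'⟩ => ?_⟩
  exact DirectSum.of_injective n (eq_of_symbol_eq hq hζ hmem
    ((hsymb ζ hζ hζ').trans (hsymb _ hmem hnil).symm))

theorem exists_nonnilpotent_unit_iff (hq : q = 1 ∨ q = -1) (n : ℕ) (r : Fin (2 * n + 2))
    (hr : Even (r : ℕ)) : (∃ φ : Cochain q (2 * n), IsUnitAt q φ r ∧ dStar q (2 * n) φ = 0 ∧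
      ¬ IsNilp q (homog q φ)) ↔ 2 ≤ (r : ℕ) := by
  have hrn : (r : ℕ) ≤ 2 * n := by
    obtain ⟨t, ht⟩ := hr
    omega
  constructor
  · rintro ⟨φ, hφ, hd, -⟩
    rw [hφ.eq_unitCochain q hrn] at hd
    exact two_le_of_dStar_unitCochain hr hrn hd
  · intro h2
    exact ⟨_, isUnitAt_unitCochain q hrn, dStar_unitCochain q hq (by simp) hr h2 hrn,
      not_isNilp_unitCochain hq (by simp) hr hrn⟩

end Cochains
end HochschildLambda

open HochschildLambda in
theorem mainTheorem3 {k : Type*} [Field k] (q : k) (hq : q = 1 ∨ q = -1) :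
    -- the positions in which `e₁` occurs are the even `r` with `2 ≤ r ≤ 2n`
    (∀ (n : ℕ) (r : Fin (2 * n + 2)), Even (r : ℕ) →
      ((∃ φ : Cochain q (2 * n), IsUnitAt q φ r ∧ dStar q (2 * n) φ = 0 ∧ ¬ IsNilp q (homog q φ)) ↔
        2 ≤ (r : ℕ))) ∧
    -- `Z^*` is graded
    (∀ z ∈ ZStar q, ∀ n, homog q (z n) ∈ ZStar q) ∧
    -- `Z^*` embeds in Hochschild cohomology, and its nonzero elements are not nilpotent there
    Disjoint (ZStar q) (coboundaries q) ∧
    (∀ z ∈ ZStar q, IsNilp q z → z = 0) ∧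
    -- `Z^*` is closed under the cup product, and isomorphic to `k[x², y²] y²`
    (∃ Z : NonUnitalSubalgebra k (C q), Z.toSubmodule = ZStar q ∧
      ∃ Φ : Z →ₙₐ[k] MvPolynomial (Fin 2) k,
        Function.Injective Φ ∧
        NonUnitalAlgHom.range Φ = evenAlg k ∧
        (∀ (n : ℕ) (r : Fin (2 * n + 2)) (φ : Cochain q (2 * n)) (h : homog q φ ∈ Z),
          Even (r : ℕ) → IsUnitAt q φ r →
            Φ ⟨homog q φ, h⟩ =
              MvPolynomial.X 0 ^ (2 * n - (r : ℕ)) * MvPolynomial.X 1 ^ (r : ℕ)) ∧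
        (∀ (n : ℕ) (φ : Cochain q n) (h : homog q φ ∈ Z),
          (Φ ⟨homog q φ, h⟩).IsHomogeneous n)) ∧
    -- `k[x², y²] y²` is not finitely generated
    (¬ ∃ s : Finset (MvPolynomial (Fin 2) k),
      NonUnitalAlgebra.adjoin k (s : Set (MvPolynomial (Fin 2) k)) = evenAlg k) ∧
    -- for `q = 1` and `char k ≠ 2`, `Z^*` is the space of cocycles of positive degree modulo
    -- nilpotent ones
    (q = 1 → (2 : k) ≠ 0 → ∀ (n : ℕ) (φ : Cochain q n), 0 < n → dStar q n φ = 0 →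
      ∃! ζ : Cochain q n, homog q ζ ∈ ZStar q ∧ IsNilp q (homog q φ - homog q ζ)) := by
  refine ⟨exists_nonnilpotent_unit_iff hq, fun z hz n => ZStar_homog_apply_mem hq hz n, ?_,
    fun z hz h => eq_zero_of_symbol_eq_zero hq hz
      (symbol_eq_zero_of_isNilp hq (ZStar_le_evenSpan hq hz) h),
    ⟨ZAlg hq, rfl, symbolHom hq, ?_, range_symbolHom hq, ?_,
      fun n φ h => isHomogeneous_symbol q φ⟩, evenAlg_not_fg, ?_⟩
  · rw [Submodule.disjoint_def]
    exact fun z hz h => eq_zero_of_symbol_eq_zero hq hz (symbol_eq_zero_of_mem_coboundaries q h)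
  · exact fun z w h => Subtype.ext (eq_of_symbol_eq hq z.2 w.2 h)
  · intro n r φ h hr hφ
    have hrn : (r : ℕ) ≤ 2 * n := by
      obtain ⟨t, ht⟩ := hr
      omega
    obtain rfl := hφ.eq_unitCochain q hrn
    exact symbol_unitCochain hrn
  · rintro rfl h2 n φ hn h
    exact existsUnique_isNilp_sub h2 hn h
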